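/- **Setting.** Let $\Theta\subseteq\mathbb{R}^p$ be compact and convex, let $f$ be continuously differentiable on an open set containing $\Theta$, with $\|\nabla f(\theta)-\nabla f(\theta')\|\le\rho\|\theta-\theta'\|$ for $\theta,\theta'\in\Theta$, and put $\varphi=f+\iota_\Theta$, where $\iota_\Theta=0$ on $\Theta$ and $+\infty$ elsewhere. For $\theta\in\Theta$ let $\partial\varphi(\theta)$ be the set of $v$ with $\varphi(\theta')\ge\varphi(\theta)+\langle v,\theta'-\theta\rangle+o(\|\theta'-\theta\|)$ as $\theta'\to\theta$, and let $\mathrm{dist}(0,A)=\inf_{a\in A}\|a\|$. Let $\pi$ be a probability measure on a sample space $\mathcal X$ and $G(\theta,x)$ a stochastic gradient (for instance $G=\nabla_\theta\ell$ when $f(\theta)=\mathbb{E}_{x\sim\pi}\ell(\theta,x)$), measurable in $x$, such that for all $\theta\in\Theta$ and $x\in\mathcal X$: $\mathbb{E}_{x\sim\pi}[G(\theta,x)]=\nabla f(\theta)$; $\theta\mapsto G(\theta,x)$ is $L_1$-Lipschitz on $\Theta$; and $\|G(\theta,x)\|\le L$. **Data.** The samples $x_1,x_2,\dots$ are exponentially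 mixing: for some $C$ and $r\in(0,1)$, for all $1\le k\le n$, $$\Delta_{[n-k,n]}:=\sup_{x_1,\dots,x_{n-k}}\big\|\mathrm{Law}(x_n\mid x_1,\dots,x_{n-k})-\pi\big\|_{TV}\le C\,r^k$$ (for a suitable version of the conditional law, or as the infimum over versions). **Algorithms.** Start at $\theta_1\in\Theta$; $\mathrm{proj}_\Theta$ is the Euclidean projection. The sequence $(\theta_t)_{t\ge1}$ is generated by one of: 1. projected SGD: $\theta_{t+1}=\mathrm{proj}_\Theta(\theta_t-\alpha_tG(\theta_t,x_{t+1}))$ with $\alpha_t=c/\sqrt t$, $c>0$; 2. AdaGrad: $v_t=v_{t-1}+\|G(\theta_t,x_{t+1})\|^2$, $\theta_{t+1}=\mathrm{proj}_\Theta\big(\theta_t-\tfrac{a}{\sqrt{v_t}}G(\theta_t,x_{t+1})\big)$ with $a,v_0>0$; 3. stochastic heavy ball: $\theta_{t+1}=\mathrm{proj}_\Theta(\theta_t-\alpha_tz_t)$, $z_{t+1}=\beta G(\theta_{t+1},x_{t+1})+\frac{1-\beta}{\alpha_{t+1}}(\theta_t-\theta_{t+1})$ with $\alpha_t=c/\sqrt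 t$, $c>0$, $\beta\in(0,1]$, and any $z_1\in\mathbb{R}^p$. **Output.** Pick $\hat t\in\{1,\dots,T\}$ independently of all samples, with $\mathbb{P}(\hat t=k)=\alpha_k/\sum_{t=1}^T\alpha_t$ for algorithms 1 and 3, and uniformly for AdaGrad. With a fresh batch $y_1,\dots,y_N$ put $$\breve\theta=\mathrm{proj}_\Theta\Big(\theta_{\hat t}-\frac1N\sum_{i=1}^NG(\theta_{\hat t},y_i)\Big).$$ Fresh means that, for all $0\le j<i\le N$, the conditional law of $y_i$ given $x_1,\dots,x_{T+1},y_1,\dots,y_j$ is within $C\,r^{i-j}$ of $\pi$ in total variation, uniformly in the conditioning values as above; this is the case if $y_i=x_{T+1+i}$ continues the stream, or if $(y_i)$ is an independent exponentially mixing stream (with the same $C$ and $r$). **Theorem.** There are $K>0$ and $q\in\mathbb{N}$, depending only on $\pi,\Theta,f,G,\rho,L,L_1,C,r$ and on the algorithm with its parameters ($c$; $a,v_0$; or $c,\beta,z_1$), such that for every $\varepsilon\in(0,1]$ there are integers $T_0,N_0\ge1$ with $$N_0\le K\varepsilon^{-2},\qquad T_0+1+N_0\le K\varepsilon^{-4}\big(1+\log(1/\varepsilon)\big)^q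 ,$$ and for all $T\ge T_0$ and $N\ge N_0$, every $\theta_1\in\Theta$, and all data as above, $$\mathbb{E}\big[\mathrm{dist}\big(0,\partial(f+\iota_\Theta)(\breve\theta)\big)\big]\le\varepsilon .$$ In particular, a minibatch of $O(\varepsilon^{-2})$ samples and $\tilde O(\varepsilon^{-4})$ samples in total suffice. -/

import Mathlib

open MeasureTheory ProbabilityTheory Topology
open scoped ENNReal NNReal RealInnerProductSpace

noncomputable section

namespace DependentSGD

/-! ### Dependent sampling -/

section Sampling

variable {S A X : Type*} [MeasurableSpace S] [MeasurableSpace A] [MeasurableSpace X]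

/-- Total variation distance `sup_B |μ(B) - ν(B)|` over measurable sets `B`. -/
def tvDist (μ ν : Measure X) : ℝ≥0∞ :=
  ⨆ (B : Set X) (_ : MeasurableSet B), ENNReal.ofReal |μ.real B - ν.real B|

/-- Worst-case total variation distance between the conditional distribution of `Y` given `H`
and the probability measure `π`, that is `sup_h ‖Law(Y | H = h) - π‖_TV`. A regular conditional
distribution is determined only up to a null set of values `h`, so the least value over all of
its versions `κ` is taken. -/
def condTV (P : Measure S) (H : S → A) (Y : S → X) (π : Measure X) : ℝ≥0∞ :=
  ⨅ (κ : Kernel A X) (_ : IsMarkovKernel κ ∧ HasCondDistrib Y H κ P), ⨆ h, tvDist (κ h) π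

/-- The history `(x₁, …, x_m)` of a sequence of samples (the entry `x 0` is never used). -/
def hist (x : ℕ → S → X) (m : ℕ) : S → (Fin m → X) := fun ω i => x (i + 1) ω

/-- `Δ_[m,n]`: worst-case total variation distance between the conditional distribution of
`x_n` given `x₁, …, x_m` and `π`. -/
def mixDelta (P : Measure S) (x : ℕ → S → X) (π : Measure X) (m n : ℕ) : ℝ≥0∞ :=
  condTV P (hist x m) (x n) π

/-- Exponential mixing: `Δ_[n-k,n] ≤ C * r ^ k` for all `1 ≤ k ≤ n` (here `m = n - k`). -/
def ExpMixing (P : Measure S) (x : ℕ → S → X) (π : Measure X) (C r : ℝ) : Prop :=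
  ∀ m n : ℕ, m < n → mixDelta P x π m n ≤ ENNReal.ofReal (C * r ^ (n - m))

/-- The samples `y₁, …, y_N` are a fresh batch taken after `x₁, …, x_n`: given
`x₁, …, x_n, y₁, …, y_j`, the law of `y_i` is within `C * r ^ (i - j)` of `π`.
This holds if the batch continues the stream (`y_i = x_{n+i}`, `x` exponentially mixing),
if it is an independent exponentially mixing stream, and if it is i.i.d. from `π`
and independent of `x₁, …, x_n`. -/
def FreshBatch (P : Measure S) (x : ℕ → S → X) (n : ℕ) (y : ℕ → S → X) (N : ℕ)
    (π : Measure X) (C r : ℝ) : Prop :=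
  ∀ i j : ℕ, j < i → i ≤ N →
    condTV P (fun ω => (hist x n ω, hist y j ω)) (y i) π ≤ ENNReal.ofReal (C * r ^ (i - j))

end Sampling

/-! ### Stationarity -/

section Optim

variable {E : Type*} [NormedAddCommGroup E] [InnerProductSpace ℝ E]

open Classical in
/-- The indicator function `ι_Θ`: `0` on `Θ` and `+∞` off `Θ`. -/
def indicatorFn (Θ : Set E) (θ : E) : EReal := if θ ∈ Θ then 0 else ⊤

/-- The constrained objective `φ = f + ι_Θ`. -/
def constrained (f : E → ℝ) (Θ : Set E) (θ : E) : EReal := (f θ : EReal) + indicatorFn Θ θ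

/-- The subdifferential of an extended-real-valued function at a point `a` where it is finite:
all `v` with `φ b ≥ φ a + ⟪v, b - a⟫ + o(‖b - a‖)` as `b → a`. -/
def subdiff (φ : E → EReal) (a : E) : Set E :=
  {v | φ a ≠ ⊤ ∧ φ a ≠ ⊥ ∧ ∀ δ : ℝ, 0 < δ →
    ∀ᶠ b in 𝓝 a, φ a + ((⟪v, b - a⟫ - δ * ‖b - a‖ : ℝ) : EReal) ≤ φ b}

/-- `dist(0, ∂(f + ι_Θ)(θ))`, equal to `∞` if the subdifferential is empty. -/
def stationarity (f : E → ℝ) (Θ : Set E) (θ : E) : ℝ≥0∞ :=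
  Metric.infEDist 0 (subdiff (constrained f Θ) θ)

/-- Euclidean projection onto `Θ`: a point of `Θ` nearest to `z`
(it exists and is unique when `Θ` is nonempty, closed and convex, in finite dimension). -/
def proj (Θ : Set E) (z : E) : E :=
  Classical.epsilon fun w => w ∈ Θ ∧ ∀ u ∈ Θ, ‖z - w‖ ≤ ‖z - u‖

/-! ### The algorithms

`G θ s` is the stochastic gradient at `θ` for the sample `s`, and `xs` is a sample path
`x₁, x₂, …`. Sequences are indexed from `1`; their entries at index `0` are placeholders. -/

variable {X : Type*}

/-- Projected stochastic gradient method: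
`θ_{t+1} = proj_Θ (θ_t - α_t G(θ_t, x_{t+1}))`. -/
def psgdIter (Θ : Set E) (G : E → X → E) (α : ℕ → ℝ) (θ₁ : E) (xs : ℕ → X) : ℕ → E
  | 0 => θ₁
  | 1 => θ₁
  | t + 2 =>
    let θ := psgdIter Θ G α θ₁ xs (t + 1)
    proj Θ (θ - α (t + 1) • G θ (xs (t + 2)))

/-- AdaGrad with scalar step sizes; the state at time `t` is `(θ_t, v_{t-1})`, and
`v_t = v_{t-1} + ‖G(θ_t, x_{t+1})‖²`,
`θ_{t+1} = proj_Θ (θ_t - (a / √v_t) G(θ_t, x_{t+1}))`. -/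
def adaGradIter (Θ : Set E) (G : E → X → E) (a v₀ : ℝ) (θ₁ : E) (xs : ℕ → X) : ℕ → E × ℝ
  | 0 => (θ₁, v₀)
  | 1 => (θ₁, v₀)
  | t + 2 =>
    let s := adaGradIter Θ G a v₀ θ₁ xs (t + 1)
    let g := G s.1 (xs (t + 2))
    let v := s.2 + ‖g‖ ^ 2
    (proj Θ (s.1 - (a / √v) • g), v)

/-- Stochastic heavy ball; the state at time `t` is `(θ_t, z_t)`, and
`θ_{t+1} = proj_Θ (θ_t - α_t z_t)`,
`z_{t+1} = β G(θ_{t+1}, x_{t+1}) + ((1 - β) / α_{t+1}) (θ_t - θ_{t+1})`. -/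
def heavyBallIter (Θ : Set E) (G : E → X → E) (α : ℕ → ℝ) (β : ℝ) (z₁ θ₁ : E)
    (xs : ℕ → X) : ℕ → E × E
  | 0 => (θ₁, z₁)
  | 1 => (θ₁, z₁)
  | t + 2 =>
    let s := heavyBallIter Θ G α β z₁ θ₁ xs (t + 1)
    let θ' := proj Θ (s.1 - α (t + 1) • s.2)
    (θ', β • G θ' (xs (t + 2)) + ((1 - β) / α (t + 2)) • (s.1 - θ'))

/-- The step sizes `α_t = c / √t`, `t ≥ 1`. -/
def stepSize (c : ℝ) (t : ℕ) : ℝ := c / √(t : ℝ)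

/-- The three algorithms with their parameters. -/
inductive Algorithm (E : Type*) where
  /-- projected stochastic gradient method with `α_t = c / √t` -/
  | psgd (c : ℝ)
  /-- AdaGrad with parameters `a` and `v₀` -/
  | adaGrad (a v₀ : ℝ)
  /-- stochastic heavy ball with `α_t = c / √t`, momentum parameter `β` and initial `z₁` -/
  | heavyBall (c β : ℝ) (z₁ : E)

/-- Admissible parameters. -/
def Algorithm.Admissible : Algorithm E → Prop
  | .psgd c => 0 < c
  | .adaGrad a v₀ => 0 < a ∧ 0 < v₀
  | .heavyBall c β _ => 0 < c ∧ 0 < β ∧ β ≤ 1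

/-- The iterate `θ_t`, `t ≥ 1`, of an algorithm started at `θ₁` and run along the path `xs`. -/
def Algorithm.iter (alg : Algorithm E) (Θ : Set E) (G : E → X → E) (θ₁ : E) (xs : ℕ → X)
    (t : ℕ) : E :=
  match alg with
  | .psgd c => psgdIter Θ G (stepSize c) θ₁ xs t
  | .adaGrad a v₀ => (adaGradIter Θ G a v₀ θ₁ xs t).1
  | .heavyBall c β z₁ => (heavyBallIter Θ G (stepSize c) β z₁ θ₁ xs t).1

/-- The unnormalized probability with which the time `t` is selected: `α_t` for the
projected stochastic gradient method and for heavy ball, uniform for AdaGrad. -/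
def Algorithm.weight : Algorithm E → ℕ → ℝ
  | .psgd c, t => stepSize c t
  | .adaGrad _ _, _ => 1
  | .heavyBall c _ _, t => stepSize c t

/-- One projected unit step from `θ` with the minibatch gradient over `ys 1, …, ys N`. -/
def minibatchStep (Θ : Set E) (G : E → X → E) (N : ℕ) (θ : E) (ys : ℕ → X) : E :=
  proj Θ (θ - (N : ℝ)⁻¹ • ∑ i ∈ Finset.Icc 1 N, G θ (ys i))

end Optim

end DependentSGD

end

/-! The potential is the Moreau envelope of `f + ι_Θ` with quadratic weight `ρ + 1`, and progress is
measured by the distance from `θ` to its proximal point. The weight exceeds the curvature loss `ρ`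
of `f` by one, so the true gradient has inner product at least the squared distance with the
direction away from the proximal point (`SmoothOn.norm_sq_le_inner_gradient`). Up to second-order
errors, each algorithm lowers the envelope in proportion to the step size times the same inner
product formed with the sampled gradient; for heavy ball this happens at extrapolated points.
Summing these inequalities is deterministic: `PathBound` holds along every sample path, so even the
data-dependent steps of AdaGrad cause no bias at this stage.

Probability enters when the sampled gradient is replaced by the true one. The noise at `θ_t` is not
centred, because the iterate and the sample are dependent. The iterate inside the noise is therefore
moved back `k` steps. The noise is Lipschitz in `θ`, so this costs the displacement over `k` steps;
and given the history up to `t - k` the sample has law within `C r^k` of `π`, so the lagged noise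
has expectation of order `r^k` (`Oracle.integral_proxNoise_le`). A lag of order `log T` yields the
rate `(1 + log T)² / √T` for the weighted mean squared distance
(`Oracle.sum_weight_mul_integral_le_rate`).

A small distance makes the proximal point nearly stationary, not the iterate itself. A unit
projected step with an approximate gradient repairs this: the residual of the projection is a normal
vector, and `SmoothOn.stationarity_proj_le` bounds the resulting subgradient by the distance plus
the gradient error. The minibatch error has mean square of order `1 / N`, as its covariances decay
geometrically (`Oracle.integral_norm_sq_batch_le`). Making both mean squares of order `ε²` gives the
two sample sizes. -/

namespace DependentSGD

section Geometry

variable {E : Type*} [NormedAddCommGroup E] [InnerProductSpace ℝ E]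

/-! ### The Euclidean projection -/

omit [InnerProductSpace ℝ E] in
theorem proj_spec {Θ : Set E} (hne : Θ.Nonempty) (hc : IsCompact Θ) (z : E) :
    proj Θ z ∈ Θ ∧ ∀ u ∈ Θ, ‖z - proj Θ z‖ ≤ ‖z - u‖ := by
  have hcont : ContinuousOn (fun w => ‖z - w‖) Θ := by fun_prop
  obtain ⟨w, hw, hmin⟩ := hc.exists_isMinOn hne hcont
  exact Classical.epsilon_spec (p := fun w => w ∈ Θ ∧ ∀ u ∈ Θ, ‖z - w‖ ≤ ‖z - u‖)
    ⟨w, hw, fun u hu => hmin hu⟩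

/-- The variational inequality satisfied by the projection. -/
theorem inner_sub_proj_nonpos {Θ : Set E} (hne : Θ.Nonempty) (hc : IsCompact Θ)
    (hv : Convex ℝ Θ) (z : E) {u : E} (hu : u ∈ Θ) :
    ⟪z - proj Θ z, u - proj Θ z⟫ ≤ 0 := by
  obtain ⟨hm, hmin⟩ := proj_spec hne hc z
  refine (norm_eq_iInf_iff_real_inner_le_zero hv hm).1 ?_ u hu
  have : Nonempty Θ := ⟨⟨_, hm⟩⟩
  refine le_antisymm (le_ciInf fun w => hmin w w.2) ?_
  exact ciInf_le ⟨0, by rintro _ ⟨w, rfl⟩; exact norm_nonneg _⟩ (⟨_, hm⟩ : Θ)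

/-- The variational inequalities at the two projections add up to firm nonexpansiveness `‖a - b‖² ≤
⟪z - z', a - b⟫`; Cauchy–Schwarz does the rest. -/
theorem norm_proj_sub_proj_le {Θ : Set E} (hne : Θ.Nonempty) (hc : IsCompact Θ)
    (hv : Convex ℝ Θ) (z z' : E) : ‖proj Θ z - proj Θ z'‖ ≤ ‖z - z'‖ := by
  have h1 := inner_sub_proj_nonpos hne hc hv z (proj_spec hne hc z').1
  have h2 := inner_sub_proj_nonpos hne hc hv z' (proj_spec hne hc z).1
  set a := proj Θ z
  set b := proj Θ z'
  have h3 : ‖a - b‖ ^ 2 ≤ ⟪z - z', a - b⟫ := by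
    rw [← real_inner_self_eq_norm_sq]
    have : ⟪z - z', a - b⟫ - ⟪a - b, a - b⟫ = -⟪z - a, b - a⟫ - ⟪z' - b, a - b⟫ := by
      rw [← neg_sub a b, inner_neg_right, ← inner_sub_left, neg_neg, ← inner_sub_left]
      congr 1; abel
    linarith
  have h4 := real_inner_le_norm (z - z') (a - b)
  by_contra hcon
  push Not at hcon
  nlinarith [norm_nonneg (z - z')]

theorem proj_eq_of_inner_nonpos {Θ : Set E} (hne : Θ.Nonempty) (hc : IsCompact Θ)
    (hv : Convex ℝ Θ) {z w : E} (hw : w ∈ Θ) (h : ∀ u ∈ Θ, ⟪z - w, u - w⟫ ≤ 0) :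
    proj Θ z = w := by
  have h1 := inner_sub_proj_nonpos hne hc hv z hw
  have h2 := h _ (proj_spec hne hc z).1
  set a := proj Θ z
  have : ‖a - w‖ ^ 2 ≤ 0 := by
    rw [← real_inner_self_eq_norm_sq]
    have : ⟪a - w, a - w⟫ = ⟪z - a, w - a⟫ + ⟪z - w, a - w⟫ := by
      rw [← neg_sub a w, inner_neg_right, ← inner_neg_left, ← inner_add_left]
      congr 1; abel
    linarith
  have h0 : ‖a - w‖ = 0 := by nlinarith [norm_nonneg (a - w)]
  exact sub_eq_zero.1 (norm_eq_zero.1 h0)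

theorem proj_eq_self {Θ : Set E} (hne : Θ.Nonempty) (hc : IsCompact Θ)
    (hv : Convex ℝ Θ) {z : E} (hz : z ∈ Θ) : proj Θ z = z :=
  proj_eq_of_inner_nonpos hne hc hv hz (by simp)

/-- A projected step from a point of `Θ` moves at most by the length of the step. -/
theorem norm_proj_add_sub_le {Θ : Set E} (hne : Θ.Nonempty) (hc : IsCompact Θ)
    (hv : Convex ℝ Θ) {θ : E} (hθ : θ ∈ Θ) (d : E) : ‖proj Θ (θ - d) - θ‖ ≤ ‖d‖ := by
  have := norm_proj_sub_proj_le hne hc hv (θ - d) θ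
  rw [proj_eq_self hne hc hv hθ] at this
  simpa using this

theorem norm_sub_proj_le {Θ : Set E} (hne : Θ.Nonempty) (hc : IsCompact Θ)
    (hv : Convex ℝ Θ) (z : E) {u : E} (hu : u ∈ Θ) : ‖u - proj Θ z‖ ≤ ‖u - z‖ := by
  simpa [proj_eq_self hne hc hv hu] using norm_proj_sub_proj_le hne hc hv u z

end Geometry

/-! ### The proximal point, the Moreau envelope and stationarity. -/

section Prox

variable {E : Type*} [NormedAddCommGroup E] [InnerProductSpace ℝ E] [CompleteSpace E]

/-- `f` is differentiable at the points of the nonempty compact convex set `Θ`, and its gradient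
is `ρ`-Lipschitz there. -/
structure SmoothOn (f : E → ℝ) (Θ : Set E) (ρ : ℝ) : Prop where
  nonempty : Θ.Nonempty
  compact : IsCompact Θ
  convex : Convex ℝ Θ
  nonneg : 0 ≤ ρ
  grad : ∀ θ ∈ Θ, HasGradientAt f (gradient f θ) θ
  lip : ∀ a ∈ Θ, ∀ b ∈ Θ, ‖gradient f a - gradient f b‖ ≤ ρ * ‖a - b‖

/-- The proximal objective with parameter `2ρ + 2`. -/
noncomputable def proxObj (f : E → ℝ) (ρ : ℝ) (θ u : E) : ℝ := f u + (ρ + 1) * ‖u - θ‖ ^ 2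

/-- The proximal point: a minimizer of the proximal objective over `Θ`. -/
noncomputable def prox (f : E → ℝ) (Θ : Set E) (ρ : ℝ) (θ : E) : E :=
  Classical.epsilon fun w => w ∈ Θ ∧ ∀ u ∈ Θ, proxObj f ρ θ w ≤ proxObj f ρ θ u

/-- The Moreau envelope of `f + ι_Θ` with parameter `2ρ + 2`. -/
noncomputable def envelope (f : E → ℝ) (Θ : Set E) (ρ : ℝ) (θ : E) : ℝ :=
  proxObj f ρ θ (prox f Θ ρ θ)

variable {f : E → ℝ} {Θ : Set E} {ρ : ℝ}

namespace SmoothOn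

theorem continuousOn (h : SmoothOn f Θ ρ) : ContinuousOn f Θ := fun θ hθ =>
  (h.grad θ hθ).continuousAt.continuousWithinAt

theorem prox_spec (h : SmoothOn f Θ ρ) (θ : E) :
    prox f Θ ρ θ ∈ Θ ∧ ∀ u ∈ Θ, proxObj f ρ θ (prox f Θ ρ θ) ≤ proxObj f ρ θ u := by
  have hcont : ContinuousOn (proxObj f ρ θ) Θ := by
    have := h.continuousOn
    unfold proxObj
    fun_prop
  obtain ⟨w, hw, hmin⟩ := h.compact.exists_isMinOn h.nonempty hcont
  exact Classical.epsilon_spec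
    (p := fun w => w ∈ Θ ∧ ∀ u ∈ Θ, proxObj f ρ θ w ≤ proxObj f ρ θ u)
    ⟨w, hw, fun u hu => hmin hu⟩

theorem prox_mem (h : SmoothOn f Θ ρ) (θ : E) : prox f Θ ρ θ ∈ Θ := (h.prox_spec θ).1

theorem envelope_le (h : SmoothOn f Θ ρ) (θ : E) {u : E} (hu : u ∈ Θ) :
    envelope f Θ ρ θ ≤ f u + (ρ + 1) * ‖u - θ‖ ^ 2 := (h.prox_spec θ).2 u hu

omit [InnerProductSpace ℝ E] [CompleteSpace E] in
theorem envelope_eq (f : E → ℝ) (Θ : Set E) (ρ : ℝ) (θ : E) :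
    envelope f Θ ρ θ = f (prox f Θ ρ θ) + (ρ + 1) * ‖prox f Θ ρ θ - θ‖ ^ 2 := rfl

/-- The first-order optimality condition at the proximal point. -/
theorem prox_inner_nonneg (h : SmoothOn f Θ ρ) (θ : E) {u : E} (hu : u ∈ Θ) :
    0 ≤ ⟪gradient f (prox f Θ ρ θ) + (2 * ρ + 2) • (prox f Θ ρ θ - θ), u - prox f Θ ρ θ⟫ := by
  obtain ⟨hm, hmin⟩ := h.prox_spec θ
  set w := prox f Θ ρ θ with hw
  have hd : HasFDerivAt (proxObj f ρ θ)
      (InnerProductSpace.toDual ℝ E (gradient f w)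
        + (ρ + 1) • (2 • (innerSL ℝ (w - θ)))) w := by
    have h1 := (h.grad w hm).hasFDerivAt
    have h2 : HasFDerivAt (fun u : E => ‖u - θ‖ ^ 2) (2 • (innerSL ℝ (w - θ))) w := by
      simpa using ((hasFDerivAt_id w).sub_const θ).norm_sq
    exact h1.add (h2.const_mul (ρ + 1))
  have hloc : IsLocalMinOn (proxObj f ρ θ) Θ w :=
    IsMinOn.localize fun u hu => hmin u hu
  have := hloc.hasFDerivWithinAt_nonneg hd.hasFDerivWithinAt
    (sub_mem_posTangentConeAt_of_segment_subset (h.convex.segment_subset hm hu))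
  simp only [add_apply, InnerProductSpace.toDual_apply_apply,
    smul_apply, innerSL_apply_apply, nsmul_eq_mul, smul_eq_mul] at this
  rw [inner_add_left, inner_smul_left]
  simp only [conj_trivial]
  push_cast at this
  linarith

/-- The quadratic contributes monotonicity `2ρ + 2` and the gradient of `f` costs at most `ρ`, so
adding the two optimality conditions gives the Lipschitz constant `(2ρ + 2) / (ρ + 2)`, which is
below `2` for every `ρ`. -/
theorem norm_prox_sub_prox_le (h : SmoothOn f Θ ρ) (θ θ' : E) :
    ‖prox f Θ ρ θ - prox f Θ ρ θ'‖ ≤ 2 * ‖θ - θ'‖ := by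
  have h1 := h.prox_inner_nonneg θ (h.prox_mem θ')
  have h2 := h.prox_inner_nonneg θ' (h.prox_mem θ)
  have h3 := h.lip _ (h.prox_mem θ) _ (h.prox_mem θ')
  have hρ := h.nonneg
  set a := prox f Θ ρ θ
  set b := prox f Θ ρ θ'
  have key : (2 * ρ + 2) * ‖a - b‖ ^ 2 + ⟪gradient f a - gradient f b, a - b⟫
      ≤ (2 * ρ + 2) * ⟪θ - θ', a - b⟫ := by
    rw [← real_inner_self_eq_norm_sq]
    have e1 : ⟪gradient f a + (2 * ρ + 2) • (a - θ), b - a⟫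
        = -⟪gradient f a, a - b⟫ - (2 * ρ + 2) * (⟪a, a - b⟫ - ⟪θ, a - b⟫) := by
      rw [← neg_sub a b, inner_neg_right, inner_add_left, inner_smul_left, inner_sub_left]
      simp only [conj_trivial]; ring
    have e2 : ⟪gradient f b + (2 * ρ + 2) • (b - θ'), a - b⟫
        = ⟪gradient f b, a - b⟫ + (2 * ρ + 2) * (⟪b, a - b⟫ - ⟪θ', a - b⟫) := by
      rw [inner_add_left, inner_smul_left, inner_sub_left]
      simp only [conj_trivial]
    rw [e1] at h1
    rw [e2] at h2
    rw [inner_sub_left a b, inner_sub_left (gradient f a), inner_sub_left θ θ']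
    linarith
  have h4 := real_inner_le_norm (θ - θ') (a - b)
  have h5 := abs_le.1 (abs_real_inner_le_norm (gradient f a - gradient f b) (a - b))
  have h6 : ‖gradient f a - gradient f b‖ * ‖a - b‖ ≤ ρ * ‖a - b‖ * ‖a - b‖ := by gcongr
  have h7 : (ρ + 2) * ‖a - b‖ ^ 2 ≤ (2 * ρ + 2) * (‖θ - θ'‖ * ‖a - b‖) := by nlinarith
  rcases (norm_nonneg (a - b)).eq_or_lt with h0 | h0
  · rw [← h0]; positivity
  · have h8 : (ρ + 2) * ‖a - b‖ ≤ (2 * ρ + 2) * ‖θ - θ'‖ := by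
      refine le_of_mul_le_mul_right ?_ h0
      linarith
    nlinarith [norm_nonneg (θ - θ')]

theorem continuous_prox (h : SmoothOn f Θ ρ) : Continuous (prox f Θ ρ) := by
  refine (LipschitzWith.of_dist_le_mul (K := 2) fun a b => ?_).continuous
  rw [dist_eq_norm, dist_eq_norm]
  exact h.norm_prox_sub_prox_le a b

/-- The mean value theorem on the segment moves the gradient to an intermediate point, at Lipschitz
cost. The constant `ρ` instead of `ρ / 2` is harmless, as the proximal weight is chosen to beat it.
-/
theorem lower_bound (h : SmoothOn f Θ ρ) {a b : E} (ha : a ∈ Θ) (hb : b ∈ Θ) :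
    f a + ⟪gradient f a, b - a⟫ - ρ * ‖b - a‖ ^ 2 ≤ f b := by
  obtain ⟨z, hz, hmv⟩ := domain_mvt
    (fun x hx => (h.grad x hx).hasFDerivAt.hasFDerivWithinAt) h.convex ha hb
  have hzΘ := h.convex.segment_subset ha hb hz
  rw [InnerProductSpace.toDual_apply_apply] at hmv
  have h1 := abs_le.1 (abs_real_inner_le_norm (gradient f z - gradient f a) (b - a))
  have h2 := h.lip z hzΘ a ha
  have h3 : ‖z - a‖ ≤ ‖b - a‖ := by
    have h5 := dist_add_dist_of_mem_segment hz
    rw [dist_comm a z, dist_eq_norm, dist_eq_norm z b, dist_comm a b, dist_eq_norm b a] at h5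
    linarith [norm_nonneg (z - b)]
  have h4 : ‖gradient f z - gradient f a‖ * ‖b - a‖ ≤ ρ * ‖b - a‖ * ‖b - a‖ := by
    gcongr
    exact h2.trans (mul_le_mul_of_nonneg_left h3 h.nonneg)
  rw [inner_sub_left] at h1
  nlinarith

/-- The gradient correlates with the direction to the proximal point. -/
theorem norm_sq_le_inner_gradient (h : SmoothOn f Θ ρ) {θ : E} (hθ : θ ∈ Θ) :
    ‖θ - prox f Θ ρ θ‖ ^ 2 ≤ ⟪gradient f θ, θ - prox f Θ ρ θ⟫ := by
  -- The loss `ρ` here against the gain `ρ + 1` in the envelope leaves exactly one copy of the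
  -- squared distance.
  have h1 := h.lower_bound hθ (h.prox_mem θ)
  have h2 := h.envelope_le θ hθ
  rw [envelope_eq] at h2
  simp only [sub_self, norm_zero] at h2
  rw [norm_sub_rev] at h1 h2
  rw [← neg_sub θ, inner_neg_right] at h1
  nlinarith

/-- Optimality says that minus the gradient of the proximal objective is normal to `Θ` at the
proximal point. In this form the proximal point can be compared with a projected gradient step by
nonexpansiveness. -/
theorem prox_eq_proj (h : SmoothOn f Θ ρ) (θ : E) :
    proj Θ (prox f Θ ρ θ - (gradient f (prox f Θ ρ θ) + (2 * ρ + 2) • (prox f Θ ρ θ - θ)))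
      = prox f Θ ρ θ := by
  refine proj_eq_of_inner_nonpos h.nonempty h.compact h.convex (h.prox_mem θ) fun u hu => ?_
  have := h.prox_inner_nonneg θ hu
  rw [sub_sub_cancel_left, inner_neg_left]
  linarith

/-- Both `proj Θ (θ - g)` and the proximal point are projections, so their distance is at most that
of the projected points: `1 + ρ + (2ρ + 2)` times the proximal distance, plus the gradient error.
Returning from the proximal point to `θ` adds one more. -/
theorem norm_proj_step_sub_le (h : SmoothOn f Θ ρ) {θ : E} (hθ : θ ∈ Θ) (g : E) :
    ‖proj Θ (θ - g) - θ‖ ≤ (3 * ρ + 4) * ‖θ - prox f Θ ρ θ‖ + ‖g - gradient f θ‖ := by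
  have h1 := norm_proj_sub_proj_le h.nonempty h.compact h.convex (θ - g)
    (prox f Θ ρ θ - (gradient f (prox f Θ ρ θ) + (2 * ρ + 2) • (prox f Θ ρ θ - θ)))
  rw [h.prox_eq_proj] at h1
  have h2 := h.lip θ hθ _ (h.prox_mem θ)
  have hρ := h.nonneg
  set w := prox f Θ ρ θ
  have e : θ - g - (w - (gradient f w + (2 * ρ + 2) • (w - θ)))
      = (θ - w) - (g - gradient f θ) - (gradient f θ - gradient f w)
        + (2 * ρ + 2) • (w - θ) := by abel
  have h3 : ‖θ - g - (w - (gradient f w + (2 * ρ + 2) • (w - θ)))‖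
      ≤ ‖θ - w‖ + ‖g - gradient f θ‖ + ‖gradient f θ - gradient f w‖
        + (2 * ρ + 2) * ‖θ - w‖ := by
    rw [e]
    refine (norm_add_le _ _).trans (add_le_add ?_ ?_)
    · exact (norm_sub_le _ _).trans (add_le_add (norm_sub_le _ _) le_rfl)
    · rw [norm_smul, Real.norm_of_nonneg (by positivity), norm_sub_rev]
  have h4 : ‖proj Θ (θ - g) - θ‖ ≤ ‖proj Θ (θ - g) - w‖ + ‖θ - w‖ := by
    rw [norm_sub_rev θ w]
    simpa using norm_add_le (proj Θ (θ - g) - w) (w - θ)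
  nlinarith

/-- Elements of the subdifferential of `f + ι_Θ`: the gradient plus a normal vector. -/
theorem add_mem_subdiff (h : SmoothOn f Θ ρ) {a n : E} (ha : a ∈ Θ)
    (hn : ∀ u ∈ Θ, ⟪n, u - a⟫ ≤ 0) :
    gradient f a + n ∈ subdiff (constrained f Θ) a := by
  have hφ : ∀ b ∈ Θ, constrained f Θ b = (f b : EReal) := fun b hb => by
    simp [constrained, indicatorFn, hb]
  refine ⟨by simp [hφ a ha], by simp [hφ a ha], fun δ hδ => ?_⟩
  have hd := (h.grad a ha).hasFDerivAt.isLittleO.def hδ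
  filter_upwards [hd] with b hb
  by_cases hbΘ : b ∈ Θ
  · rw [hφ a ha, hφ b hbΘ, ← EReal.coe_add, EReal.coe_le_coe_iff]
    rw [InnerProductSpace.toDual_apply_apply, Real.norm_eq_abs] at hb
    have := (abs_le.1 hb).1
    have h2 := hn b hbΘ
    rw [inner_add_left]
    linarith
  · have : constrained f Θ b = ⊤ := by simp [constrained, indicatorFn, hbΘ]
    rw [this]; exact le_top

/-- With `b` the projected point, `θ - g - b` is normal to `Θ` at `b`, so `∇f(b) + θ - g - b` is a
subgradient. Its norm is at most `(ρ + 1)‖b - θ‖` plus the gradient error, and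
`norm_proj_step_sub_le` bounds the displacement. -/
theorem stationarity_proj_le (h : SmoothOn f Θ ρ) {θ : E} (hθ : θ ∈ Θ) (g : E) :
    stationarity f Θ (proj Θ (θ - g)) ≤ ENNReal.ofReal
      ((3 * ρ + 4) ^ 2 * ‖θ - prox f Θ ρ θ‖ + (ρ + 2) * ‖g - gradient f θ‖) := by
  obtain ⟨hm, -⟩ := proj_spec h.nonempty h.compact (θ - g)
  have hmem := h.add_mem_subdiff hm
    (fun u hu => inner_sub_proj_nonpos h.nonempty h.compact h.convex (θ - g) hu)
  refine (Metric.infEDist_le_edist_of_mem hmem).trans ?_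
  rw [edist_comm, edist_zero_right, ← ofReal_norm]
  refine ENNReal.ofReal_le_ofReal ?_
  have h1 := h.norm_proj_step_sub_le hθ g
  have h2 := h.lip _ hm θ hθ
  have hρ := h.nonneg
  set b := proj Θ (θ - g)
  have e : gradient f b + (θ - g - b)
      = (gradient f b - gradient f θ) - (g - gradient f θ) - (b - θ) := by abel
  rw [e]
  have h3 := norm_sub_le (gradient f b - gradient f θ - (g - gradient f θ)) (b - θ)
  have h4 := norm_sub_le (gradient f b - gradient f θ) (g - gradient f θ)
  have h5 : (ρ + 1) * ‖b - θ‖ ≤ (ρ + 1) *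
    ((3 * ρ + 4) * ‖θ - prox f Θ ρ θ‖ + ‖g - gradient f θ‖) := by gcongr
  have h6 : 0 ≤ (3 * ρ + 4) * (2 * ρ + 3) * ‖θ - prox f Θ ρ θ‖ := by positivity
  nlinarith

theorem exists_abs_le (h : SmoothOn f Θ ρ) : ∃ M : ℝ, 0 ≤ M ∧ ∀ θ ∈ Θ, |f θ| ≤ M := by
  obtain ⟨M, hM⟩ := h.compact.exists_bound_of_continuousOn h.continuousOn
  exact ⟨max M 0, le_max_right _ _, fun θ hθ => (hM θ hθ).trans (le_max_left _ _)⟩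

theorem exists_norm_sub_le (h : SmoothOn f Θ ρ) :
    ∃ D : ℝ, 0 ≤ D ∧ ∀ a ∈ Θ, ∀ b ∈ Θ, ‖a - b‖ ≤ D := by
  refine ⟨Metric.diam Θ, Metric.diam_nonneg, fun a ha b hb => ?_⟩
  rw [← dist_eq_norm]
  exact Metric.dist_le_diam_of_mem h.compact.isBounded ha hb

end SmoothOn

end Prox

/-! ### Total variation and conditional expectations. -/

section Decoupling

variable {S A X : Type*} [MeasurableSpace S] [MeasurableSpace A] [MeasurableSpace X]

theorem abs_measureReal_sub_le_of_tvDist {μ ν : Measure X} {d : ℝ} (hd : 0 ≤ d)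
    (h : tvDist μ ν ≤ ENNReal.ofReal d) {B : Set X} (hB : MeasurableSet B) :
    |μ.real B - ν.real B| ≤ d :=
  (ENNReal.ofReal_le_ofReal_iff hd).1 ((le_iSup₂ (f := fun (B : Set X) (_ : MeasurableSet B) =>
    ENNReal.ofReal |μ.real B - ν.real B|) B hB).trans h)

theorem integrable_of_abs_le {μ : Measure X} [IsFiniteMeasure μ] {φ : X → ℝ}
    (hφ : Measurable φ) {M : ℝ} (hM : ∀ s, |φ s| ≤ M) : Integrable φ μ :=
  Integrable.of_bound hφ.aestronglyMeasurable M (ae_of_all _ hM)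

/-- Layer cake: after adding `M` the function takes values in `[0, 2M]`, and each superlevel set
changes its mass by at most `d`, over a range of levels of length `2M`. -/
theorem integral_le_integral_add {μ ν : Measure X} [IsProbabilityMeasure μ]
    [IsProbabilityMeasure ν] {d : ℝ} (hd : 0 ≤ d)
    (h : ∀ B, MeasurableSet B → |μ.real B - ν.real B| ≤ d) {φ : X → ℝ} (hφ : Measurable φ)
    {M : ℝ} (hM : ∀ s, |φ s| ≤ M) : ∫ s, φ s ∂μ ≤ ∫ s, φ s ∂ν + 2 * M * d := by
  obtain ⟨s₀⟩ := nonempty_of_isProbabilityMeasure μ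
  have hM0 : 0 ≤ M := (abs_nonneg _).trans (hM s₀)
  set ψ : X → ℝ := fun s => φ s + M
  have hψm : Measurable ψ := hφ.add_const M
  have hψ0 : ∀ s, 0 ≤ ψ s := fun s => by have := (abs_le.1 (hM s)).1; simp only [ψ]; linarith
  have hψ1 : ∀ s, ψ s ≤ 2 * M := fun s => by have := (abs_le.1 (hM s)).2; simp only [ψ]; linarith
  have hle : ∀ t : ℝ, 0 < t → μ {a | t < ψ a} ≤
      ν {a | t < ψ a} + (Set.Iio (2 * M)).indicator (fun _ => ENNReal.ofReal d) t := by
    intro t _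
    by_cases ht2 : t < 2 * M
    · rw [Set.indicator_of_mem (by exact ht2), ← ofReal_measureReal, ← ofReal_measureReal,
        ← ENNReal.ofReal_add measureReal_nonneg hd]
      have := (abs_le.1 (h {a | t < ψ a} (measurableSet_lt measurable_const hψm))).2
      exact ENNReal.ofReal_le_ofReal (by linarith)
    · have : {a | t < ψ a} = ∅ := by
        ext a; simp only [Set.mem_ofPred_eq, Set.mem_empty_iff_false, iff_false, not_lt]
        exact (hψ1 a).trans (not_lt.1 ht2)
      simp [this]
  have key : ∫⁻ s, ENNReal.ofReal (ψ s) ∂μ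
      ≤ ∫⁻ s, ENNReal.ofReal (ψ s) ∂ν + ENNReal.ofReal (2 * M * d) := by
    rw [lintegral_eq_lintegral_meas_lt μ (ae_of_all _ hψ0) hψm.aemeasurable,
      lintegral_eq_lintegral_meas_lt ν (ae_of_all _ hψ0) hψm.aemeasurable]
    refine (setLIntegral_mono' measurableSet_Ioi fun t ht => hle t ht).trans ?_
    rw [lintegral_add_right _ (measurable_const.indicator measurableSet_Iio)]
    gcongr
    rw [lintegral_indicator measurableSet_Iio, setLIntegral_const,
      Measure.restrict_apply measurableSet_Iio, Set.Iio_inter_Ioi, Real.volume_Ioo, sub_zero,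
      mul_comm, ENNReal.ofReal_mul (by positivity : 0 ≤ 2 * M)]
  have hint : ∀ (m : Measure X) [IsProbabilityMeasure m],
      ∫ s, ψ s ∂m = ∫ s, φ s ∂m + M := fun m _ => by
    simp only [ψ]
    rw [integral_add (integrable_of_abs_le hφ hM) (integrable_const _)]
    simp
  have hψi : ∀ (m : Measure X) [IsProbabilityMeasure m], Integrable ψ m := fun m _ =>
    (integrable_of_abs_le hφ hM).add (integrable_const _)
  rw [← ofReal_integral_eq_lintegral_ofReal (hψi μ) (ae_of_all _ hψ0),
    ← ofReal_integral_eq_lintegral_ofReal (hψi ν) (ae_of_all _ hψ0),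
    ← ENNReal.ofReal_add (integral_nonneg hψ0) (by positivity),
    ENNReal.ofReal_le_ofReal_iff (add_nonneg (integral_nonneg hψ0) (by positivity)),
    hint μ, hint ν] at key
  linarith

/-- Integrals of bounded functions are controlled by the total variation distance. -/
theorem abs_integral_sub_integral_le {μ ν : Measure X} [IsProbabilityMeasure μ]
    [IsProbabilityMeasure ν] {d : ℝ} (hd : 0 ≤ d) (h : tvDist μ ν ≤ ENNReal.ofReal d)
    {φ : X → ℝ} (hφ : Measurable φ) {M : ℝ} (hM : ∀ s, |φ s| ≤ M) :
    |∫ s, φ s ∂μ - ∫ s, φ s ∂ν| ≤ 2 * M * d := by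
  have h' : ∀ B, MeasurableSet B → |μ.real B - ν.real B| ≤ d := fun B hB =>
    abs_measureReal_sub_le_of_tvDist hd h hB
  have h1 := integral_le_integral_add hd h' hφ hM
  have h2 := integral_le_integral_add (μ := ν) (ν := μ) hd
    (fun B hB => by rw [abs_sub_comm]; exact h' B hB) hφ hM
  rw [abs_le]; constructor <;> linarith

/-- If the conditional law of `Y` given `H` is close to `π`, a bounded function of `(H, Y)` that
is centred under `π` in its second argument has small expectation. -/
theorem abs_integral_le_of_condTV {P : Measure S} [IsProbabilityMeasure P] {H : S → A}
    {Y : S → X} {π : Measure X} [IsProbabilityMeasure π] {d : ℝ} (hd : 0 ≤ d)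
    (h : condTV P H Y π ≤ ENNReal.ofReal d) {Φ : A × X → ℝ} (hΦ : Measurable Φ) {M : ℝ}
    (hM : ∀ z, |Φ z| ≤ M) (hz : ∀ a, ∫ s, Φ (a, s) ∂π = 0) :
    |∫ ω, Φ (H ω, Y ω) ∂P| ≤ 2 * M * d := by
  obtain ⟨ω₀⟩ := nonempty_of_isProbabilityMeasure P
  have hM0 : 0 ≤ M := (abs_nonneg _).trans (hM (H ω₀, Y ω₀))
  -- The infimum over versions of the conditional law need not be attained, so a version within `d +
  -- δ` is used and `δ` tends to zero.
  suffices hs : ∀ δ : ℝ, 0 < δ → |∫ ω, Φ (H ω, Y ω) ∂P| ≤ 2 * M * (d + δ) by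
    refine le_of_forall_pos_le_add fun e he => ?_
    refine (hs (e / (2 * M + 1)) (by positivity)).trans ?_
    rw [mul_add]
    gcongr
    rw [mul_div_assoc', div_le_iff₀ (by positivity)]
    nlinarith
  intro δ hδ
  have hlt : condTV P H Y π < ENNReal.ofReal (d + δ) :=
    h.trans_lt ((ENNReal.ofReal_lt_ofReal_iff (by linarith)).2 (by linarith))
  unfold condTV at hlt
  simp only [iInf_lt_iff] at hlt
  obtain ⟨κ, ⟨hκ, hY⟩, hlt⟩ := hlt
  have htv : ∀ a, tvDist (κ a) π ≤ ENNReal.ofReal (d + δ) := fun a =>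
    (le_iSup (fun a => tvDist (κ a) π) a).trans hlt.le
  have hae : AEMeasurable H P := hY.aemeasurable_fst
  have hlaw : P.map (fun ω => (H ω, Y ω)) = P.map H ⊗ₘ κ := HasLaw.map_eq hY
  have hpair : AEMeasurable (fun ω => (H ω, Y ω)) P := HasLaw.aemeasurable hY
  have : IsProbabilityMeasure (P.map H) := Measure.isProbabilityMeasure_map hae
  rw [← integral_map (f := Φ) hpair hΦ.aestronglyMeasurable, hlaw,
    Measure.integral_compProd (integrable_of_abs_le hΦ hM)]
  refine (abs_integral_le_integral_abs).trans ?_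
  have hb : ∀ a, |∫ s, Φ (a, s) ∂(κ a)| ≤ 2 * M * (d + δ) := fun a => by
    have := abs_integral_sub_integral_le (by linarith) (htv a)
      (hΦ.comp measurable_prodMk_left) (fun s => hM (a, s))
    simpa [hz a, Function.comp_def] using this
  calc ∫ a, |∫ s, Φ (a, s) ∂(κ a)| ∂(P.map H) ≤ ∫ _, 2 * M * (d + δ) ∂(P.map H) := by
        refine integral_mono_of_nonneg (ae_of_all _ fun a => abs_nonneg _)
          (integrable_const _) (ae_of_all _ hb)
    _ = 2 * M * (d + δ) := by simp

end Decoupling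

/-! ### Sums of displacements and geometric sums. -/

section Sums

theorem sum_Ioc_shift_le {F : ℕ → ℝ} (hF : ∀ s, 0 ≤ F s) {k T j : ℕ} (hj : j < k) :
    ∑ t ∈ Finset.Ioc k T, F (t - k + j) ≤ ∑ s ∈ Finset.Icc 1 T, F s := by
  rw [← Finset.sum_image (g := fun t => t - k + j) (f := F)]
  · refine Finset.sum_le_sum_of_subset_of_nonneg (fun s hs => ?_) fun s _ _ => hF s
    simp only [Finset.mem_image, Finset.mem_Ioc, Finset.mem_Icc] at hs ⊢
    omega
  · intro a ha b hb hab
    simp only [Finset.coe_Ioc, Set.mem_Ioc] at ha hb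
    simp only at hab
    omega

/-- Weighted displacements over `k` steps are at most `k` times the weighted displacements over
single steps, if the weights decrease. -/
theorem sum_weight_mul_displacement_le {E : Type*} [SeminormedAddCommGroup E] {w : ℕ → ℝ}
    (hw0 : ∀ t, 0 ≤ w t) (hw : ∀ s t, 1 ≤ s → s ≤ t → w t ≤ w s) (θ : ℕ → E) (k T : ℕ) :
    ∑ t ∈ Finset.Ioc k T, w t * ‖θ t - θ (t - k)‖
      ≤ k * ∑ s ∈ Finset.Icc 1 T, w s * ‖θ (s + 1) - θ s‖ := by
  calc ∑ t ∈ Finset.Ioc k T, w t * ‖θ t - θ (t - k)‖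
      ≤ ∑ t ∈ Finset.Ioc k T, ∑ j ∈ Finset.range k,
          w (t - k + j) * ‖θ (t - k + j + 1) - θ (t - k + j)‖ := by
        refine Finset.sum_le_sum fun t ht => ?_
        rw [Finset.mem_Ioc] at ht
        have h1 : ‖θ t - θ (t - k)‖
            ≤ ∑ j ∈ Finset.range k, ‖θ (t - k + j + 1) - θ (t - k + j)‖ := by
          have := Finset.sum_range_sub (fun j => θ (t - k + j)) k
          simp only [add_zero, Nat.sub_add_cancel ht.1.le] at this
          rw [← this]
          exact norm_sum_le _ _
        refine (mul_le_mul_of_nonneg_left h1 (hw0 t)).trans ?_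
        rw [Finset.mul_sum]
        refine Finset.sum_le_sum fun j hj => ?_
        rw [Finset.mem_range] at hj
        exact mul_le_mul_of_nonneg_right (hw _ _ (by omega) (by omega)) (norm_nonneg _)
    _ = ∑ j ∈ Finset.range k, ∑ t ∈ Finset.Ioc k T,
          w (t - k + j) * ‖θ (t - k + j + 1) - θ (t - k + j)‖ := Finset.sum_comm
    _ ≤ ∑ j ∈ Finset.range k, ∑ s ∈ Finset.Icc 1 T, w s * ‖θ (s + 1) - θ s‖ :=
        Finset.sum_le_sum fun j hj => sum_Ioc_shift_le
          (F := fun s => w s * ‖θ (s + 1) - θ s‖)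
          (fun s => mul_nonneg (hw0 s) (norm_nonneg _)) (Finset.mem_range.1 hj)
    _ = k * ∑ s ∈ Finset.Icc 1 T, w s * ‖θ (s + 1) - θ s‖ := by simp

theorem sum_Icc_pow_le {r : ℝ} (hr₀ : 0 ≤ r) (hr₁ : r < 1) (n : ℕ) :
    ∑ j ∈ Finset.Icc 1 n, r ^ (n + 1 - j) ≤ (1 - r)⁻¹ := by
  have h1 : ∑ j ∈ Finset.Icc 1 n, r ^ (n + 1 - j) = ∑ j ∈ Finset.Icc 1 n, r ^ j :=
    Finset.sum_bij' (fun j _ => n + 1 - j) (fun j _ => n + 1 - j)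
      (by simp only [Finset.mem_Icc]; omega) (by simp only [Finset.mem_Icc]; omega)
      (by simp only [Finset.mem_Icc]; omega) (by simp only [Finset.mem_Icc]; omega)
      (by simp)
  rw [h1, ← tsum_geometric_of_lt_one hr₀ hr₁]
  exact (summable_geometric_of_lt_one hr₀ hr₁).sum_le_tsum _ fun j _ => pow_nonneg hr₀ j

end Sums

/-! ### The gradient noise under mixing data. -/

section Noise

variable {E X : Type*} [NormedAddCommGroup E] [InnerProductSpace ℝ E] [CompleteSpace E]
  [SecondCountableTopology E] [MeasurableSpace E] [BorelSpace E] [MeasurableSpace X]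

/-- An adapted process in `Θ`: the value at time `t` is a measurable function of the sample path
that depends only on its entries `1, …, t`. -/
structure IsAdapted (Θ : Set E) (it : (ℕ → X) → ℕ → E) : Prop where
  mem : ∀ xs t, it xs t ∈ Θ
  meas : ∀ t, Measurable fun xs => it xs t
  dep : ∀ t xs xs', (∀ n, 1 ≤ n → n ≤ t → xs n = xs' n) → it xs t = it xs' t

/-- A jointly measurable, bounded, Lipschitz and unbiased stochastic gradient of a smooth
function. -/
structure Oracle (π : Measure X) (f : E → ℝ) (Θ : Set E) (G : E → X → E) (ρ L₁ L D : ℝ) :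
    Prop where
  smooth : SmoothOn f Θ ρ
  meas : Measurable (Function.uncurry G)
  mean : ∀ θ ∈ Θ, ∫ s, G θ s ∂π = gradient f θ
  lip : ∀ s, ∀ a ∈ Θ, ∀ b ∈ Θ, ‖G a s - G b s‖ ≤ L₁ * ‖a - b‖
  bdd : ∀ θ ∈ Θ, ∀ s, ‖G θ s‖ ≤ L
  diam : ∀ a ∈ Θ, ∀ b ∈ Θ, ‖a - b‖ ≤ D
  lip_nonneg : 0 ≤ L₁
  bdd_nonneg : 0 ≤ L
  diam_nonneg : 0 ≤ D

/-- The noise of the stochastic gradient in the direction of the proximal point. -/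
noncomputable def proxNoise (f : E → ℝ) (Θ : Set E) (ρ : ℝ) (G : E → X → E) (θ : E) (s : X) : ℝ :=
  ⟪G θ s - gradient f θ, prox f Θ ρ θ - θ⟫

/-- Extension of a finite history to a sample path. -/
noncomputable def extendHist (s₀ : X) (m : ℕ) (h : Fin m → X) : ℕ → X := fun n =>
  if hn : 1 ≤ n ∧ n ≤ m then h ⟨n - 1, by omega⟩ else s₀

theorem measurable_extendHist (s₀ : X) (m : ℕ) : Measurable (extendHist s₀ m) := by
  refine measurable_pi_lambda _ fun n => ?_
  unfold extendHist
  by_cases hn : 1 ≤ n ∧ n ≤ m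
  · simp only [hn, and_self, dite_true]
    exact measurable_pi_apply _
  · simp only [hn, dite_false]
    exact measurable_const

omit [MeasurableSpace X] in
theorem extendHist_hist {S : Type*} (x : ℕ → S → X) (s₀ : X) {m n : ℕ} (h1 : 1 ≤ n)
    (h2 : n ≤ m) (ω : S) : extendHist s₀ m (hist x m ω) n = x n ω := by
  simp [extendHist, hist, h1, h2]

variable {π : Measure X} {f : E → ℝ} {Θ : Set E} {G : E → X → E} {ρ L₁ L D : ℝ}

omit [SecondCountableTopology E] in
theorem measurable_gradient (f : E → ℝ) : Measurable (gradient f) := by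
  unfold gradient
  exact (LinearIsometryEquiv.continuous _).measurable.comp (measurable_fderiv ℝ f)

namespace Oracle

omit [SecondCountableTopology E] [BorelSpace E] in
theorem norm_gradient_le (h : Oracle π f Θ G ρ L₁ L D) [IsProbabilityMeasure π] {θ : E}
    (hθ : θ ∈ Θ) : ‖gradient f θ‖ ≤ L := by
  rw [← h.mean θ hθ]
  simpa using norm_integral_le_of_norm_le_const (μ := π) (ae_of_all _ (h.bdd θ hθ))

omit [SecondCountableTopology E] [BorelSpace E] in
theorem norm_sub_gradient_le (h : Oracle π f Θ G ρ L₁ L D) [IsProbabilityMeasure π] {θ : E}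
    (hθ : θ ∈ Θ) (s : X) : ‖G θ s - gradient f θ‖ ≤ 2 * L := by
  have h1 := norm_sub_le (G θ s) (gradient f θ)
  have h2 := h.bdd θ hθ s
  have h3 := h.norm_gradient_le hθ
  linarith

theorem measurable_sub_gradient (h : Oracle π f Θ G ρ L₁ L D) :
    Measurable fun z : E × X => G z.1 z.2 - gradient f z.1 :=
  h.meas.sub ((measurable_gradient f).comp measurable_fst)

theorem integrable (h : Oracle π f Θ G ρ L₁ L D) [IsProbabilityMeasure π] {θ : E}
    (hθ : θ ∈ Θ) : Integrable (G θ) π :=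
  Integrable.of_bound (h.meas.comp measurable_prodMk_left).aestronglyMeasurable L
    (ae_of_all _ (h.bdd θ hθ))

theorem integral_inner_sub_gradient (h : Oracle π f Θ G ρ L₁ L D) [IsProbabilityMeasure π]
    {θ : E} (hθ : θ ∈ Θ) (v : E) : ∫ s, ⟪v, G θ s - gradient f θ⟫ ∂π = 0 := by
  have hi : Integrable (fun s => G θ s - gradient f θ) π :=
    (h.integrable hθ).sub (integrable_const _)
  rw [integral_inner hi, integral_sub (h.integrable hθ) (integrable_const _), h.mean θ hθ]
  simp

theorem integral_proxNoise (h : Oracle π f Θ G ρ L₁ L D) [IsProbabilityMeasure π]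
    {θ : E} (hθ : θ ∈ Θ) : ∫ s, proxNoise f Θ ρ G θ s ∂π = 0 := by
  simp only [proxNoise, real_inner_comm (prox f Θ ρ θ - θ)]
  simpa only [real_inner_comm] using h.integral_inner_sub_gradient hθ (prox f Θ ρ θ - θ)

theorem abs_proxNoise_le (h : Oracle π f Θ G ρ L₁ L D) [IsProbabilityMeasure π] {θ : E}
    (hθ : θ ∈ Θ) (s : X) : |proxNoise f Θ ρ G θ s| ≤ 2 * L * D := by
  have hL := h.bdd_nonneg
  refine (abs_real_inner_le_norm _ _).trans ?_
  exact mul_le_mul (h.norm_sub_gradient_le hθ s) (h.diam _ (h.smooth.prox_mem θ) _ hθ)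
    (norm_nonneg _) (by positivity)

theorem measurable_proxNoise (h : Oracle π f Θ G ρ L₁ L D) :
    Measurable fun z : E × X => proxNoise f Θ ρ G z.1 z.2 :=
  h.measurable_sub_gradient.inner
    ((h.smooth.continuous_prox.measurable.comp measurable_fst).sub measurable_fst)

/-- The noise is an inner product of two bounded Lipschitz factors: the gradient error, of size `2L`
and Lipschitz constant `L₁ + ρ`, and the proximal displacement, of size `D` and Lipschitz constant
`2 + 1`. -/
theorem proxNoise_sub_le (h : Oracle π f Θ G ρ L₁ L D) [IsProbabilityMeasure π] {a b : E}
    (ha : a ∈ Θ) (hb : b ∈ Θ) (s : X) :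
    proxNoise f Θ ρ G a s
      ≤ ((L₁ + ρ) * D + 6 * L) * ‖a - b‖ + proxNoise f Θ ρ G b s := by
  have hL := h.bdd_nonneg
  have hL₁ := h.lip_nonneg
  have hρ := h.smooth.nonneg
  have e : proxNoise f Θ ρ G a s - proxNoise f Θ ρ G b s
      = ⟪(G a s - G b s) - (gradient f a - gradient f b), prox f Θ ρ a - a⟫
        + ⟪G b s - gradient f b, (prox f Θ ρ a - prox f Θ ρ b) - (a - b)⟫ := by
    have e1 : prox f Θ ρ a - prox f Θ ρ b - (a - b)
        = (prox f Θ ρ a - a) - (prox f Θ ρ b - b) := by abel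
    have e2 : (G a s - G b s) - (gradient f a - gradient f b)
        = (G a s - gradient f a) - (G b s - gradient f b) := by abel
    rw [e1, e2, inner_sub_left, inner_sub_right _ (prox f Θ ρ a - a)]
    unfold proxNoise
    ring
  have h1 : ‖(G a s - G b s) - (gradient f a - gradient f b)‖ ≤ (L₁ + ρ) * ‖a - b‖ := by
    have := norm_sub_le (G a s - G b s) (gradient f a - gradient f b)
    have := h.lip s a ha b hb
    have := h.smooth.lip a ha b hb
    linarith
  have h2 : ‖(prox f Θ ρ a - prox f Θ ρ b) - (a - b)‖ ≤ 3 * ‖a - b‖ := by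
    have := norm_sub_le (prox f Θ ρ a - prox f Θ ρ b) (a - b)
    have := h.smooth.norm_prox_sub_prox_le a b
    linarith
  have h3 := (real_inner_le_norm ((G a s - G b s) - (gradient f a - gradient f b))
    (prox f Θ ρ a - a)).trans (mul_le_mul h1 (h.diam _ (h.smooth.prox_mem a) _ ha)
      (norm_nonneg _) (by positivity))
  have h4 := (real_inner_le_norm (G b s - gradient f b)
    ((prox f Θ ρ a - prox f Θ ρ b) - (a - b))).trans
      (mul_le_mul (h.norm_sub_gradient_le hb s) h2 (norm_nonneg _) (by positivity))
  nlinarith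

variable {S : Type*} [MeasurableSpace S] {P : Measure S} [IsProbabilityMeasure P]
  [IsProbabilityMeasure π] {x y : ℕ → S → X} {it : (ℕ → X) → ℕ → E} {C r : ℝ}

/-- The conditional bias of the stochastic gradient at a past iterate. -/
theorem integral_proxNoise_le (h : Oracle π f Θ G ρ L₁ L D) (hit : IsAdapted Θ it)
    (hC : 0 ≤ C) (hr₀ : 0 < r) (hr₁ : r < 1) (hmix : ExpMixing P x π C r) {m n k : ℕ}
    (hmn : m < n) (hk : m + k ≤ n) :
    ∫ ω, proxNoise f Θ ρ G (it (fun n => x n ω) m) (x n ω) ∂P ≤ 4 * L * D * C * r ^ k := by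
  obtain ⟨s₀⟩ := nonempty_of_isProbabilityMeasure π
  have hL := h.bdd_nonneg
  have hD := h.diam_nonneg
  -- The iterate becomes a function of the finite history padded with an arbitrary `s₀`; adaptedness
  -- makes the padding invisible.
  set Φ : (Fin m → X) × X → ℝ := fun z =>
    proxNoise f Θ ρ G (it (extendHist s₀ m z.1) m) z.2 with hΦ
  have hΦm : Measurable Φ := h.measurable_proxNoise.comp
    ((((hit.meas m).comp (measurable_extendHist s₀ m)).comp measurable_fst).prodMk measurable_snd)
  have key := abs_integral_le_of_condTV (P := P) (H := hist x m) (Y := x n) (π := π)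
    (d := C * r ^ (n - m)) (by positivity) (hmix m n hmn) hΦm
    (M := 2 * L * D) (fun z => h.abs_proxNoise_le (hit.mem _ _) _)
    (fun a => by simp only [hΦ]; exact h.integral_proxNoise (hit.mem _ _))
  have he : ∀ ω, Φ (hist x m ω, x n ω)
      = proxNoise f Θ ρ G (it (fun n => x n ω) m) (x n ω) := fun ω => by
    simp only [hΦ]
    rw [hit.dep m _ (fun n => x n ω) fun i h1 h2 => extendHist_hist x s₀ h1 h2 ω]
  simp only [he] at key
  refine (le_abs_self _).trans (key.trans ?_)
  have : r ^ (n - m) ≤ r ^ k := pow_le_pow_of_le_one hr₀.le hr₁.le (by omega)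
  calc 2 * (2 * L * D) * (C * r ^ (n - m)) ≤ 2 * (2 * L * D) * (C * r ^ k) := by gcongr
    _ = _ := by ring

/-- From pathwise bounds along an adapted process to a bound on the expected squared distances
to the proximal points. -/
theorem sum_weight_mul_integral_le (h : Oracle π f Θ G ρ L₁ L D) (hit : IsAdapted Θ it)
    (hx : ∀ n, Measurable (x n))
    (hC : 0 ≤ C) (hr₀ : 0 < r) (hr₁ : r < 1) (hmix : ExpMixing P x π C r)
    {w : ℕ → ℝ} (hw0 : ∀ t, 0 ≤ w t) (hw : ∀ s t, 1 ≤ s → s ≤ t → w t ≤ w s)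
    {σ : ℕ → ℕ} (hσ : ∀ t, t ≤ σ t) {T k : ℕ} (hk : 1 ≤ k) {B B' : ℝ}
    (hB : ∀ xs, ∑ t ∈ Finset.Icc 1 T, w t * ‖it xs (t + 1) - it xs t‖ ≤ B)
    (hB' : ∀ xs, ∑ t ∈ Finset.Icc 1 T,
      w t * ⟪G (it xs t) (xs (σ t)), it xs t - prox f Θ ρ (it xs t)⟫ ≤ B') :
    ∑ t ∈ Finset.Icc 1 T,
      w t * ∫ ω, ‖it (fun n => x n ω) t - prox f Θ ρ (it (fun n => x n ω) t)‖ ^ 2 ∂P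
    ≤ B' + k * w 1 * (2 * L * D) + ((L₁ + ρ) * D + 6 * L) * (k * B)
      + 4 * L * D * C * r ^ k * ∑ t ∈ Finset.Icc 1 T, w t := by
  have hL := h.bdd_nonneg
  have hD := h.diam_nonneg
  have hL₁ := h.lip_nonneg
  have hρ := h.smooth.nonneg
  set Λ := (L₁ + ρ) * D + 6 * L
  have hΛ : 0 ≤ Λ := by positivity
  -- Still pathwise: the first `k` noise terms are bounded crudely, and in the later ones the
  -- iterate is replaced by the one `k` steps earlier. Only the lagged noise is left for the
  -- expectation.
  have hpath : ∀ xs : ℕ → X, ∑ t ∈ Finset.Icc 1 T, w t * ‖it xs t - prox f Θ ρ (it xs t)‖ ^ 2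
      ≤ (B' + k * w 1 * (2 * L * D) + Λ * (k * B))
        + ∑ t ∈ Finset.Ioc k T, w t * proxNoise f Θ ρ G (it xs (t - k)) (xs (σ t)) := by
    intro xs
    have h1 : ∑ t ∈ Finset.Icc 1 T, w t * ‖it xs t - prox f Θ ρ (it xs t)‖ ^ 2
        ≤ ∑ t ∈ Finset.Icc 1 T,
            w t * ⟪G (it xs t) (xs (σ t)), it xs t - prox f Θ ρ (it xs t)⟫
          + ∑ t ∈ Finset.Icc 1 T, w t * proxNoise f Θ ρ G (it xs t) (xs (σ t)) := by
      rw [← Finset.sum_add_distrib]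
      refine Finset.sum_le_sum fun t _ => ?_
      rw [← mul_add]
      refine mul_le_mul_of_nonneg_left ((h.smooth.norm_sq_le_inner_gradient (hit.mem xs t)).trans
        (le_of_eq ?_)) (hw0 t)
      unfold proxNoise
      rw [← neg_sub (it xs t) (prox f Θ ρ (it xs t)), inner_neg_right, inner_sub_left]
      ring
    have h2 : ∑ t ∈ Finset.Icc 1 T, w t * proxNoise f Θ ρ G (it xs t) (xs (σ t))
        ≤ ∑ t ∈ Finset.Icc 1 k, w 1 * (2 * L * D)
          + ∑ t ∈ Finset.Ioc k T, w t * (Λ * ‖it xs t - it xs (t - k)‖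
            + proxNoise f Θ ρ G (it xs (t - k)) (xs (σ t))) := by
      -- The lag may exceed `T`, hence a filter for the initial block.
      have hsplit : Finset.Icc 1 T
          = (Finset.Icc 1 T).filter (· ≤ k) ∪ Finset.Ioc k T := by
        ext t; simp only [Finset.mem_union, Finset.mem_filter, Finset.mem_Icc, Finset.mem_Ioc]
        omega
      have hdisj : Disjoint ((Finset.Icc 1 T).filter (· ≤ k)) (Finset.Ioc k T) := by
        rw [Finset.disjoint_left]; intro t
        simp only [Finset.mem_filter, Finset.mem_Icc, Finset.mem_Ioc]
        omega
      conv_lhs => rw [hsplit, Finset.sum_union hdisj]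
      refine add_le_add ?_ (Finset.sum_le_sum fun t _ => mul_le_mul_of_nonneg_left
        (h.proxNoise_sub_le (hit.mem _ _) (hit.mem _ _) _) (hw0 t))
      calc ∑ t ∈ (Finset.Icc 1 T).filter (· ≤ k), w t * proxNoise f Θ ρ G (it xs t) (xs (σ t))
          ≤ ∑ t ∈ (Finset.Icc 1 T).filter (· ≤ k), w 1 * (2 * L * D) := by
            refine Finset.sum_le_sum fun t ht => ?_
            simp only [Finset.mem_filter, Finset.mem_Icc] at ht
            calc w t * proxNoise f Θ ρ G (it xs t) (xs (σ t))
                ≤ w t * (2 * L * D) := mul_le_mul_of_nonneg_left ((le_abs_self _).trans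
                  (h.abs_proxNoise_le (hit.mem _ _) _)) (hw0 t)
              _ ≤ w 1 * (2 * L * D) :=
                mul_le_mul_of_nonneg_right (hw 1 t le_rfl ht.1.1) (by positivity)
        _ ≤ ∑ t ∈ Finset.Icc 1 k, w 1 * (2 * L * D) := by
            have := hw0 1
            refine Finset.sum_le_sum_of_subset_of_nonneg (fun t ht => ?_)
              fun _ _ _ => by positivity
            simp only [Finset.mem_filter, Finset.mem_Icc] at ht ⊢
            exact ⟨ht.1.1, ht.2⟩
    have h3 := sum_weight_mul_displacement_le hw0 hw (it xs) k T
    have h4 : Λ * ∑ t ∈ Finset.Ioc k T, w t * ‖it xs t - it xs (t - k)‖ ≤ Λ * (k * B) := by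
      refine mul_le_mul_of_nonneg_left (h3.trans ?_) hΛ
      exact mul_le_mul_of_nonneg_left (hB xs) (Nat.cast_nonneg k)
    have h5 : ∑ t ∈ Finset.Ioc k T, w t * (Λ * ‖it xs t - it xs (t - k)‖
            + proxNoise f Θ ρ G (it xs (t - k)) (xs (σ t)))
        = Λ * ∑ t ∈ Finset.Ioc k T, w t * ‖it xs t - it xs (t - k)‖
          + ∑ t ∈ Finset.Ioc k T, w t * proxNoise f Θ ρ G (it xs (t - k)) (xs (σ t)) := by
      rw [Finset.mul_sum, ← Finset.sum_add_distrib]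
      exact Finset.sum_congr rfl fun t _ => by ring
    have h6 : ∑ t ∈ Finset.Icc 1 k, w 1 * (2 * L * D) = k * w 1 * (2 * L * D) := by
      simp; ring
    have := hB' xs
    linarith
  have hpm : Measurable fun ω => (fun n => x n ω : ℕ → X) := measurable_pi_lambda _ hx
  have hitm : ∀ t, Measurable fun ω => it (fun n => x n ω) t := fun t => (hit.meas t).comp hpm
  have hi1 : ∀ t, Integrable
      (fun ω => ‖it (fun n => x n ω) t - prox f Θ ρ (it (fun n => x n ω) t)‖ ^ 2) P := fun t => by
    refine integrable_of_abs_le (M := D ^ 2) (((hitm t).sub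
      (h.smooth.continuous_prox.measurable.comp (hitm t))).norm.pow_const 2) fun ω => ?_
    rw [abs_of_nonneg (by positivity)]
    have := h.diam _ (hit.mem (fun n => x n ω) t) _ (h.smooth.prox_mem (it (fun n => x n ω) t))
    gcongr
  have hi2 : ∀ t, Integrable
      (fun ω => proxNoise f Θ ρ G (it (fun n => x n ω) (t - k)) (x (σ t) ω)) P := fun t =>
    integrable_of_abs_le (h.measurable_proxNoise.comp ((hitm (t - k)).prodMk (hx (σ t))))
      fun ω => h.abs_proxNoise_le (hit.mem _ _) _
  have hint := integral_mono (μ := P)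
    (integrable_finsetSum (Finset.Icc 1 T) fun t _ => (hi1 t).const_mul (w t))
    ((integrable_const (B' + k * w 1 * (2 * L * D) + Λ * (k * B))).add
      (integrable_finsetSum (Finset.Ioc k T) fun t _ => (hi2 t).const_mul (w t)))
    fun ω => hpath (fun n => x n ω)
  rw [integral_finsetSum _ fun t _ => (hi1 t).const_mul (w t),
    integral_add' (integrable_const _)
      (integrable_finsetSum (Finset.Ioc k T) fun t _ => (hi2 t).const_mul (w t)),
    integral_finsetSum _ fun t _ => (hi2 t).const_mul (w t)] at hint
  simp only [integral_const_mul, integral_const, probReal_univ, one_smul] at hint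
  refine hint.trans (add_le_add le_rfl ?_)
  rw [Finset.mul_sum]
  calc ∑ t ∈ Finset.Ioc k T, w t *
        ∫ ω, proxNoise f Θ ρ G (it (fun n => x n ω) (t - k)) (x (σ t) ω) ∂P
      ≤ ∑ t ∈ Finset.Ioc k T, 4 * L * D * C * r ^ k * w t := by
        refine Finset.sum_le_sum fun t ht => ?_
        rw [Finset.mem_Ioc] at ht
        rw [mul_comm (4 * L * D * C * r ^ k)]
        -- The sample used at time `t` has index at least `t`, hence at least `k` beyond that of the
        -- lagged iterate.
        have := hσ t
        exact mul_le_mul_of_nonneg_left (h.integral_proxNoise_le hit hC hr₀ hr₁ hmix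
          (by omega) (by omega)) (hw0 t)
    _ ≤ ∑ t ∈ Finset.Icc 1 T, 4 * L * D * C * r ^ k * w t := by
        refine Finset.sum_le_sum_of_subset_of_nonneg (fun t ht => ?_) fun t _ _ => ?_
        · simp only [Finset.mem_Ioc, Finset.mem_Icc] at ht ⊢; omega
        · have := hw0 t; positivity

/-- The second moment of the sum of the centred minibatch gradients grows linearly. -/
theorem integral_norm_sq_batch_le (h : Oracle π f Θ G ρ L₁ L D) (hit : IsAdapted Θ it)
    (hx : ∀ n, Measurable (x n)) (hy : ∀ n, Measurable (y n))
    (hC : 0 ≤ C) (hr₀ : 0 < r) (hr₁ : r < 1) {n N t : ℕ} (ht : t ≤ n)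
    (hfresh : FreshBatch P x n y N π C r) :
    ∀ N' ≤ N, ∫ ω, ‖∑ i ∈ Finset.Icc 1 N', (G (it (fun n => x n ω) t) (y i ω)
        - gradient f (it (fun n => x n ω) t))‖ ^ 2 ∂P
      ≤ N' * (16 * L ^ 2 * C * (1 - r)⁻¹ + 4 * L ^ 2) := by
  obtain ⟨s₀⟩ := nonempty_of_isProbabilityMeasure π
  have hL := h.bdd_nonneg
  have hpm : Measurable fun ω => (fun n => x n ω : ℕ → X) := measurable_pi_lambda _ hx
  have hitm : Measurable fun ω => it (fun n => x n ω) t := (hit.meas t).comp hpm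
  set e : ℕ → S → E := fun i ω =>
    G (it (fun n => x n ω) t) (y i ω) - gradient f (it (fun n => x n ω) t) with he
  have hem : ∀ i, Measurable (e i) := fun i =>
    h.measurable_sub_gradient.comp (hitm.prodMk (hy i))
  have heb : ∀ i ω, ‖e i ω‖ ≤ 2 * L := fun i ω => h.norm_sub_gradient_le (hit.mem _ _) _
  have hinn : ∀ i j ω, |⟪e j ω, e i ω⟫| ≤ 4 * L ^ 2 := fun i j ω => by
    refine (abs_real_inner_le_norm _ _).trans ((mul_le_mul (heb j ω) (heb i ω)
      (norm_nonneg _) (by positivity)).trans (le_of_eq (by ring)))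
  have hii : ∀ i j, Integrable (fun ω => ⟪e j ω, e i ω⟫) P := fun i j =>
    integrable_of_abs_le ((hem j).inner (hem i)) (hinn i j)
  -- The error `e j` is a function of the conditioning history `x₁, …, x_n, y₁, …, y_j`, while `e i`
  -- is centred when `y_i` is drawn from `π`.
  have hcov : ∀ i j, 1 ≤ j → j < i → i ≤ N →
      ∫ ω, ⟪e j ω, e i ω⟫ ∂P ≤ 8 * L ^ 2 * C * r ^ (i - j) := by
    intro i j hj hji hiN
    set Θh : (Fin n → X) × (Fin j → X) → E := fun z => it (extendHist s₀ n z.1) t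
    have hΘm : Measurable Θh :=
      ((hit.meas t).comp (measurable_extendHist s₀ n)).comp measurable_fst
    have hym : Measurable fun z : (Fin n → X) × (Fin j → X) => extendHist s₀ j z.2 j :=
      (measurable_pi_apply j).comp ((measurable_extendHist s₀ j).comp measurable_snd)
    set Φ : ((Fin n → X) × (Fin j → X)) × X → ℝ := fun z =>
      ⟪G (Θh z.1) (extendHist s₀ j z.1.2 j) - gradient f (Θh z.1),
        G (Θh z.1) z.2 - gradient f (Θh z.1)⟫ with hΦ
    have hΦm : Measurable Φ :=
      (h.measurable_sub_gradient.comp ((hΘm.prodMk hym).comp measurable_fst)).inner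
        (h.measurable_sub_gradient.comp ((hΘm.comp measurable_fst).prodMk measurable_snd))
    have key := abs_integral_le_of_condTV (P := P)
      (H := fun ω => (hist x n ω, hist y j ω)) (Y := y i) (π := π)
      (d := C * r ^ (i - j)) (by positivity) (hfresh i j hji hiN) hΦm (M := 4 * L ^ 2)
      (fun z => (abs_real_inner_le_norm _ _).trans ((mul_le_mul
        (h.norm_sub_gradient_le (hit.mem _ _) _) (h.norm_sub_gradient_le (hit.mem _ _) _)
        (norm_nonneg _) (by positivity)).trans (le_of_eq (by ring))))
      (fun a => by simp only [hΦ]; exact h.integral_inner_sub_gradient (hit.mem _ _) _)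
    have heq : ∀ ω, Φ ((hist x n ω, hist y j ω), y i ω) = ⟪e j ω, e i ω⟫ := fun ω => by
      simp only [hΦ, he, Θh]
      rw [hit.dep t _ (fun n => x n ω)
        fun l h1 h2 => extendHist_hist x s₀ h1 (h2.trans ht) ω, extendHist_hist y s₀ hj le_rfl]
    simp only [heq] at key
    exact (le_abs_self _).trans (key.trans (le_of_eq (by ring)))
  intro N'
  induction N' with
  | zero => intro _; simp
  | succ m ih =>
    intro hm
    have ih : ∫ ω, ‖∑ i ∈ Finset.Icc 1 m, e i ω‖ ^ 2 ∂P
      ≤ m * (16 * L ^ 2 * C * (1 - r)⁻¹ + 4 * L ^ 2) := ih (by omega)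
    -- A new term adds its own square and twice its covariances with the earlier terms, whose sum is
    -- a geometric series bounded independently of `m`.
    have hexp : ∀ ω, ‖∑ i ∈ Finset.Icc 1 (m + 1), e i ω‖ ^ 2
        = ‖∑ i ∈ Finset.Icc 1 m, e i ω‖ ^ 2
          + (2 * ∑ j ∈ Finset.Icc 1 m, ⟪e j ω, e (m + 1) ω⟫ + ‖e (m + 1) ω‖ ^ 2) := fun ω => by
      rw [Finset.sum_Icc_succ_top (by omega), norm_add_sq_real, sum_inner]
      ring
    have hS : Integrable (fun ω => ‖∑ i ∈ Finset.Icc 1 m, e i ω‖ ^ 2) P := by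
      refine integrable_of_abs_le (M := (m * (2 * L)) ^ 2)
        ((Finset.measurable_sum _ fun i _ => hem i).norm.pow_const 2) fun ω => ?_
      rw [abs_of_nonneg (by positivity)]
      gcongr
      refine (norm_sum_le _ _).trans ((Finset.sum_le_sum fun i _ => heb i ω).trans (le_of_eq ?_))
      simp
    have hsq : Integrable (fun ω => ‖e (m + 1) ω‖ ^ 2) P := by
      simpa only [real_inner_self_eq_norm_sq] using hii (m + 1) (m + 1)
    have hsum : Integrable (fun ω => ∑ j ∈ Finset.Icc 1 m, ⟪e j ω, e (m + 1) ω⟫) P :=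
      integrable_finsetSum _ fun j _ => hii (m + 1) j
    change ∫ ω, ‖∑ i ∈ Finset.Icc 1 (m + 1), e i ω‖ ^ 2 ∂P ≤ _
    have hcross : Integrable (fun ω => 2 * ∑ j ∈ Finset.Icc 1 m, ⟪e j ω, e (m + 1) ω⟫
        + ‖e (m + 1) ω‖ ^ 2) P := (hsum.const_mul 2).add hsq
    simp only [hexp]
    rw [integral_add hS hcross, integral_add (hsum.const_mul 2) hsq,
      integral_const_mul, integral_finsetSum _ fun j _ => hii (m + 1) j]
    have h1 : ∫ ω, ‖e (m + 1) ω‖ ^ 2 ∂P ≤ 4 * L ^ 2 := by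
      have := integral_mono hsq (integrable_const (4 * L ^ 2)) fun ω => by
        have := heb (m + 1) ω
        calc ‖e (m + 1) ω‖ ^ 2 ≤ (2 * L) ^ 2 := by gcongr
          _ = 4 * L ^ 2 := by ring
      simpa using this
    have h2 : ∑ j ∈ Finset.Icc 1 m, ∫ ω, ⟪e j ω, e (m + 1) ω⟫ ∂P
        ≤ 8 * L ^ 2 * C * (1 - r)⁻¹ := by
      calc ∑ j ∈ Finset.Icc 1 m, ∫ ω, ⟪e j ω, e (m + 1) ω⟫ ∂P
          ≤ ∑ j ∈ Finset.Icc 1 m, 8 * L ^ 2 * C * r ^ (m + 1 - j) := by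
            refine Finset.sum_le_sum fun j hj => ?_
            rw [Finset.mem_Icc] at hj
            exact hcov (m + 1) j hj.1 (by omega) hm
        _ = 8 * L ^ 2 * C * ∑ j ∈ Finset.Icc 1 m, r ^ (m + 1 - j) := by rw [Finset.mul_sum]
        _ ≤ _ := mul_le_mul_of_nonneg_left (sum_Icc_pow_le hr₀.le hr₁ m) (by positivity)
    push_cast
    linarith

end Oracle

end Noise

/-! ### Step-size sums and summation by parts. -/

section StepSizes

theorem sum_Icc_sub_succ (F : ℕ → ℝ) (T : ℕ) :
    ∑ t ∈ Finset.Icc 1 T, (F t - F (t + 1)) = F 1 - F (T + 1) := by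
  induction T with
  | zero => simp
  | succ n ih => rw [Finset.sum_Icc_succ_top (by omega), ih]; ring

/-- Summation by parts with increasing weights and bounded values. -/
theorem sum_mul_sub_succ_le {b F : ℕ → ℝ} {M : ℝ} (hb0 : 0 ≤ b 0) (hb : Monotone b)
    (hF : ∀ t, F t ≤ M) (T : ℕ) :
    ∑ t ∈ Finset.Icc 1 T, b t * (F t - F (t + 1)) ≤ b T * (M - F (T + 1)) := by
  induction T with
  | zero => simpa using mul_nonneg hb0 (sub_nonneg.2 (hF 1))
  | succ n ih =>
    rw [Finset.sum_Icc_succ_top (by omega)]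
    have h1 : b n * (M - F (n + 1)) ≤ b (n + 1) * (M - F (n + 1)) :=
      mul_le_mul_of_nonneg_right (hb (Nat.le_succ n)) (sub_nonneg.2 (hF _))
    linarith

theorem sum_Icc_stepSize_sq_le (c : ℝ) (T : ℕ) :
    ∑ t ∈ Finset.Icc 1 T, stepSize c t ^ 2 ≤ c ^ 2 * (1 + Real.log T) := by
  have h1 : ∑ t ∈ Finset.Icc 1 T, stepSize c t ^ 2 = c ^ 2 * (harmonic T : ℝ) := by
    rw [harmonic_eq_sum_Icc]
    push_cast
    rw [Finset.mul_sum]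
    refine Finset.sum_congr rfl fun t _ => ?_
    rw [stepSize, div_pow, Real.sq_sqrt (Nat.cast_nonneg t), div_eq_mul_inv]
  rw [h1]
  exact mul_le_mul_of_nonneg_left (harmonic_le_one_add_log T) (sq_nonneg c)

theorem stepSize_nonneg {c : ℝ} (hc : 0 ≤ c) (t : ℕ) : 0 ≤ stepSize c t := by
  unfold stepSize; positivity

theorem stepSize_anti {c : ℝ} (hc : 0 ≤ c) {s t : ℕ} (hs : 1 ≤ s) (hst : s ≤ t) :
    stepSize c t ≤ stepSize c s := by
  unfold stepSize
  have : (0 : ℝ) < s := by exact_mod_cast hs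
  gcongr

/-- Decreasing steps sum to at least `T` times the last one, which is `c √T`. This lets a bound of
order `1 + log T` be read as a rate relative to the total weight. -/
theorem le_sum_stepSize_div_sqrt {c : ℝ} (hc : 0 ≤ c) {T : ℕ} (hT : 1 ≤ T) :
    c ≤ (∑ t ∈ Finset.Icc 1 T, stepSize c t) / √(T : ℝ) := by
  have hT0 : (0 : ℝ) < T := by exact_mod_cast hT
  rw [le_div_iff₀ (Real.sqrt_pos.2 hT0)]
  calc c * √(T : ℝ) = ∑ t ∈ Finset.Icc 1 T, stepSize c T := by
        simp only [Finset.sum_const, Nat.card_Icc, add_tsub_cancel_right, nsmul_eq_mul, stepSize]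
        rw [mul_div_assoc', eq_div_iff (Real.sqrt_pos.2 hT0).ne', mul_assoc,
          Real.mul_self_sqrt hT0.le, mul_comm]
    _ ≤ ∑ t ∈ Finset.Icc 1 T, stepSize c t := Finset.sum_le_sum fun t ht => by
        rw [Finset.mem_Icc] at ht
        exact stepSize_anti hc ht.1 ht.2

end StepSizes

/-! ### One-step change of the envelope. -/

section Steps

variable {E : Type*} [NormedAddCommGroup E] [InnerProductSpace ℝ E] [CompleteSpace E]
  {f : E → ℝ} {Θ : Set E} {ρ M : ℝ}

namespace SmoothOn

theorem envelope_le_of_mem (h : SmoothOn f Θ ρ) (hM : ∀ θ ∈ Θ, |f θ| ≤ M) {θ : E}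
    (hθ : θ ∈ Θ) : envelope f Θ ρ θ ≤ M := by
  have := h.envelope_le θ hθ
  simp only [sub_self, norm_zero] at this
  have := (abs_le.1 (hM θ hθ)).2
  linarith

theorem neg_le_envelope (h : SmoothOn f Θ ρ) (hM : ∀ θ ∈ Θ, |f θ| ≤ M) (θ : E) :
    -M ≤ envelope f Θ ρ θ := by
  rw [envelope_eq]
  have h1 := (abs_le.1 (hM _ (h.prox_mem θ))).1
  have h2 : 0 ≤ (ρ + 1) * ‖prox f Θ ρ θ - θ‖ ^ 2 := by have := h.nonneg; positivity
  linarith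

/-- Change of the Moreau envelope under a projected step. -/
theorem envelope_proj_le (h : SmoothOn f Θ ρ) (θ d : E) :
    envelope f Θ ρ (proj Θ (θ - d)) ≤ envelope f Θ ρ θ
      + (ρ + 1) * (‖d‖ ^ 2 - 2 * ⟪d, θ - prox f Θ ρ θ⟫) := by
  -- The old proximal point competes in the new envelope; it lies in `Θ`, so the projection does not
  -- move away from it.
  have h1 := h.envelope_le (proj Θ (θ - d)) (h.prox_mem θ)
  have h2 := norm_sub_proj_le h.nonempty h.compact h.convex (θ - d) (h.prox_mem θ)
  rw [envelope_eq f Θ ρ θ]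
  have hρ := h.nonneg
  have h3 : ‖prox f Θ ρ θ - proj Θ (θ - d)‖ ^ 2 ≤ ‖prox f Θ ρ θ - (θ - d)‖ ^ 2 := by gcongr
  have h4 : ‖prox f Θ ρ θ - (θ - d)‖ ^ 2
      = ‖prox f Θ ρ θ - θ‖ ^ 2 + ‖d‖ ^ 2 - 2 * ⟪d, θ - prox f Θ ρ θ⟫ := by
    rw [← sub_add, norm_add_sq_real, ← neg_sub θ, inner_neg_left, real_inner_comm]
    ring
  have h5 := mul_le_mul_of_nonneg_left (h3.trans_eq h4) (by linarith : 0 ≤ ρ + 1)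
  linarith

/-- Change of the Moreau envelope at the extrapolated iterates of heavy ball. -/
theorem envelope_heavyBall_le (h : SmoothOn f Θ ρ) {L α β : ℝ} (hL : 0 ≤ L) (hα : 0 ≤ α)
    (hβ0 : 0 < β) (hβ1 : β ≤ 1) {θ q g : E} (hg : ‖g‖ ≤ L) {p : E}
    (hp : p = proj Θ (θ - ((β * α) • g - (1 - β) • q)) - θ) :
    envelope f Θ ρ (θ + p + ((1 - β) / β) • p) ≤ envelope f Θ ρ (θ + ((1 - β) / β) • q)
      + (ρ + 1) * (2 * L ^ 2 * α ^ 2 + 10 * β⁻¹ ^ 2 * (‖p‖ ^ 2 + ‖q‖ ^ 2)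
        - 2 * (α * ⟪g, θ - prox f Θ ρ θ⟫)) := by
  have hρ := h.nonneg
  set l := (1 - β) / β with hl
  have hl0 : 0 ≤ l := div_nonneg (by linarith) hβ0.le
  have hμ : β⁻¹ = 1 + l := by rw [hl]; field_simp; ring
  set θb := θ + l • q with hθb
  set u := prox f Θ ρ θb
  set e := (1 + l) • p - l • q with he
  have hnext : θ + p + l • p = θb + e := by rw [hθb, he]; module
  have h1 := h.envelope_le (θ + p + l • p) (h.prox_mem θb)
  have h2 : ‖u - (θ + p + l • p)‖ ^ 2 = ‖u - θb‖ ^ 2 - 2 * ⟪e, u - θb⟫ + ‖e‖ ^ 2 := by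
    rw [hnext, ← sub_sub, norm_sub_sq_real, real_inner_comm]
  have h3 := inner_sub_proj_nonpos h.nonempty h.compact h.convex
    (θ - ((β * α) • g - (1 - β) • q)) (h.prox_mem θb)
  have hθ' : proj Θ (θ - ((β * α) • g - (1 - β) • q)) = θ + p := by rw [hp]; abel
  -- The residual of the projection is `-β (e + α g)`. Without the constraint `e = -α g`, so the
  -- extrapolated point makes a plain gradient step; with it, an inequality survives in directions
  -- into `Θ`.
  have hvi : -⟪e, u - (θ + p)⟫ ≤ α * ⟪g, u - (θ + p)⟫ := by
    rw [hθ'] at h3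
    have e1 : θ - ((β * α) • g - (1 - β) • q) - (θ + p) = (-β) • (e + α • g) := by
      have hb : β * (1 + l) = 1 := by rw [← hμ]; exact mul_inv_cancel₀ hβ0.ne'
      have hb' : β * l = 1 - β := by linarith
      rw [he, smul_add, smul_sub, smul_smul, smul_smul, smul_smul, neg_mul, neg_mul, neg_mul,
        hb, hb']
      module
    rw [e1, inner_smul_left, inner_add_left, inner_smul_left] at h3
    simp only [conj_trivial] at h3
    have : 0 ≤ ⟪e, u - (θ + p)⟫ + α * ⟪g, u - (θ + p)⟫ := by
      by_contra hcon
      push Not at hcon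
      nlinarith
    linarith
  -- The variational inequality is based at `θ + p`, not at the extrapolated point; the mismatch is
  -- quadratic in the displacements.
  have hsplit : ⟪e, u - θb⟫ = ⟪e, u - (θ + p)⟫ + ⟪e, p - l • q⟫ := by
    rw [← inner_add_right, hθb]; congr 1; abel
  -- Here the proximal point of the extrapolated point is exchanged for that of `θ`, by the
  -- Lipschitz bound for `prox`.
  have hg2 : ⟪g, u - (θ + p)⟫ ≤ -⟪g, θ - prox f Θ ρ θ⟫ + L * (2 * l * ‖q‖) + L * ‖p‖ := by
    have e1 : u - (θ + p) = -(θ - prox f Θ ρ θ) + (u - prox f Θ ρ θ) + -p := by abel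
    rw [e1, inner_add_right, inner_add_right, inner_neg_right]
    have h4 := h.norm_prox_sub_prox_le θb θ
    have h5 : ‖θb - θ‖ = l * ‖q‖ := by
      rw [hθb, add_sub_cancel_left, norm_smul, Real.norm_of_nonneg hl0]
    have h6 := (real_inner_le_norm g (u - prox f Θ ρ θ)).trans
      (mul_le_mul hg h4 (norm_nonneg _) hL)
    have h7 := (real_inner_le_norm g (-p)).trans
      (mul_le_mul_of_nonneg_right hg (norm_nonneg _))
    rw [norm_neg] at h7
    rw [h5] at h6
    linarith
  have hcross : -2 * ⟪e, p - l • q⟫ ≤ ‖e‖ ^ 2 + ‖p - l • q‖ ^ 2 := by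
    have := norm_add_sq_real e (p - l • q)
    nlinarith [sq_nonneg ‖e + (p - l • q)‖]
  have hpar : ∀ a b : E, ‖a - b‖ ^ 2 ≤ 2 * ‖a‖ ^ 2 + 2 * ‖b‖ ^ 2 := fun a b => by
    have := parallelogram_law_with_norm ℝ a b
    nlinarith [norm_nonneg (a + b)]
  have hn : ∀ (s : ℝ) (v : E), ‖s • v‖ ^ 2 = s ^ 2 * ‖v‖ ^ 2 := fun s v => by
    rw [norm_smul, mul_pow, Real.norm_eq_abs, sq_abs]
  have hn1 := hpar p (l • q)
  have hn2 := hpar ((1 + l) • p) (l • q)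
  rw [← he] at hn2
  rw [hn] at hn1
  rw [hn, hn] at hn2
  have ha1 : 2 * (α * (L * (2 * l * ‖q‖))) ≤ L ^ 2 * α ^ 2 + 4 * l ^ 2 * ‖q‖ ^ 2 := by
    nlinarith [sq_nonneg (L * α - 2 * l * ‖q‖)]
  have ha2 : 2 * (α * (L * ‖p‖)) ≤ L ^ 2 * α ^ 2 + ‖p‖ ^ 2 := by
    nlinarith [sq_nonneg (L * α - ‖p‖)]
  have hg3 := mul_le_mul_of_nonneg_left hg2 hα
  -- The constant `10 = 4 + 2 + 4` is set by `q`: from `2‖e‖²`, from `‖p - l • q‖²`, and from the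
  -- Young inequality `ha1`.
  have hfin : -2 * ⟪e, u - θb⟫ + ‖e‖ ^ 2 ≤ 2 * L ^ 2 * α ^ 2
      + 10 * β⁻¹ ^ 2 * (‖p‖ ^ 2 + ‖q‖ ^ 2) - 2 * (α * ⟪g, θ - prox f Θ ρ θ⟫) := by
    rw [hsplit, hμ]
    have hq := mul_nonneg hl0 (sq_nonneg ‖q‖)
    have hp' := mul_nonneg hl0 (sq_nonneg ‖p‖)
    have hp2 := mul_nonneg (sq_nonneg l) (sq_nonneg ‖p‖)
    nlinarith [sq_nonneg ‖p‖, sq_nonneg ‖q‖]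
  rw [envelope_eq f Θ ρ θb]
  rw [h2] at h1
  have := mul_le_mul_of_nonneg_left hfin (by linarith : 0 ≤ ρ + 1)
  linarith

end SmoothOn

end Steps

/-! ### The iterates as adapted processes in `Θ`. -/

section Iterates

variable {E X : Type*} [NormedAddCommGroup E] [InnerProductSpace ℝ E]
  {Θ : Set E} {G : E → X → E}

theorem continuous_proj (hne : Θ.Nonempty) (hc : IsCompact Θ) (hv : Convex ℝ Θ) :
    Continuous (proj Θ) := by
  refine (LipschitzWith.of_dist_le_mul (K := 1) fun a b => ?_).continuous
  rw [dist_eq_norm, dist_eq_norm, NNReal.coe_one, one_mul]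
  exact norm_proj_sub_proj_le hne hc hv a b

theorem psgdIter_mem (hne : Θ.Nonempty) (hc : IsCompact Θ) (G : E → X → E) (α : ℕ → ℝ) {θ₁ : E}
    (hθ₁ : θ₁ ∈ Θ) (xs : ℕ → X) : ∀ t, psgdIter Θ G α θ₁ xs t ∈ Θ
  | 0 => hθ₁
  | 1 => hθ₁
  | _ + 2 => (proj_spec hne hc _).1

theorem adaGradIter_mem (hne : Θ.Nonempty) (hc : IsCompact Θ) (G : E → X → E) (a v₀ : ℝ) {θ₁ : E}
    (hθ₁ : θ₁ ∈ Θ) (xs : ℕ → X) : ∀ t, (adaGradIter Θ G a v₀ θ₁ xs t).1 ∈ Θ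
  | 0 => hθ₁
  | 1 => hθ₁
  | _ + 2 => (proj_spec hne hc _).1

theorem heavyBallIter_mem (hne : Θ.Nonempty) (hc : IsCompact Θ) (G : E → X → E) (α : ℕ → ℝ)
    (β : ℝ) (z₁ : E) {θ₁ : E} (hθ₁ : θ₁ ∈ Θ) (xs : ℕ → X) :
    ∀ t, (heavyBallIter Θ G α β z₁ θ₁ xs t).1 ∈ Θ
  | 0 => hθ₁
  | 1 => hθ₁
  | _ + 2 => (proj_spec hne hc _).1

/-- The iterates only see the stochastic gradient at points of `Θ`. -/
theorem Algorithm.iter_congr (alg : Algorithm E) (hne : Θ.Nonempty) (hc : IsCompact Θ)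
    {G' : E → X → E} (hG : ∀ θ ∈ Θ, G θ = G' θ) {θ₁ : E} (hθ₁ : θ₁ ∈ Θ) (xs : ℕ → X) (t : ℕ) :
    alg.iter Θ G θ₁ xs t = alg.iter Θ G' θ₁ xs t := by
  cases alg with
  | psgd c =>
    change psgdIter Θ G _ θ₁ xs t = psgdIter Θ G' _ θ₁ xs t
    induction t with
    | zero => rfl
    | succ n ih =>
      cases n with
      | zero => rfl
      | succ n =>
        simp only [psgdIter]
        rw [hG _ (psgdIter_mem hne hc G _ hθ₁ xs (n + 1)), ih]
  | adaGrad a v₀ =>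
    refine congrArg Prod.fst
      (?_ : adaGradIter Θ G a v₀ θ₁ xs t = adaGradIter Θ G' a v₀ θ₁ xs t)
    induction t with
    | zero => rfl
    | succ n ih =>
      cases n with
      | zero => rfl
      | succ n =>
        simp only [adaGradIter]
        rw [hG _ (adaGradIter_mem hne hc G a v₀ hθ₁ xs (n + 1)), ih]
  | heavyBall c β z₁ =>
    refine congrArg Prod.fst
      (?_ : heavyBallIter Θ G _ β z₁ θ₁ xs t = heavyBallIter Θ G' _ β z₁ θ₁ xs t)
    induction t with
    | zero => rfl
    | succ n ih =>
      cases n with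
      | zero => rfl
      | succ n =>
        simp only [heavyBallIter]
        rw [hG _ (proj_spec hne hc _).1, ih]

variable [SecondCountableTopology E] [MeasurableSpace E] [BorelSpace E] [MeasurableSpace X]

theorem isAdapted_psgdIter (hne : Θ.Nonempty) (hc : IsCompact Θ) (hv : Convex ℝ Θ)
    (hG : Measurable (Function.uncurry G)) (α : ℕ → ℝ) {θ₁ : E} (hθ₁ : θ₁ ∈ Θ) :
    IsAdapted Θ (psgdIter Θ G α θ₁) where
  mem xs t := psgdIter_mem hne hc G α hθ₁ xs t
  meas t := by
    induction t with
    | zero => exact measurable_const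
    | succ n ih =>
      cases n with
      | zero => exact measurable_const
      | succ n =>
        refine (continuous_proj hne hc hv).measurable.comp (ih.sub (Measurable.const_smul ?_ _))
        exact hG.comp (ih.prodMk (measurable_pi_apply (n + 2)))
  dep t xs xs' h := by
    induction t with
    | zero => rfl
    | succ n ih =>
      cases n with
      | zero => rfl
      | succ n =>
        have ih := ih fun i h1 h2 => h i h1 (by omega)
        simp only [psgdIter, ih, h (n + 2) (by omega) (by omega)]

theorem isAdapted_adaGradIter (hne : Θ.Nonempty) (hc : IsCompact Θ) (hv : Convex ℝ Θ)
    (hG : Measurable (Function.uncurry G)) (a v₀ : ℝ) {θ₁ : E} (hθ₁ : θ₁ ∈ Θ) :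
    IsAdapted Θ fun xs t => (adaGradIter Θ G a v₀ θ₁ xs t).1 where
  mem xs t := adaGradIter_mem hne hc G a v₀ hθ₁ xs t
  meas t := by
    refine Measurable.fst (?_ : Measurable fun xs => adaGradIter Θ G a v₀ θ₁ xs t)
    induction t with
    | zero => exact measurable_const
    | succ n ih =>
      cases n with
      | zero => exact measurable_const
      | succ n =>
        have hg : Measurable fun xs : ℕ → X =>
            G (adaGradIter Θ G a v₀ θ₁ xs (n + 1)).1 (xs (n + 2)) :=
          hG.comp (ih.fst.prodMk (measurable_pi_apply (n + 2)))
        have hvm := ih.snd.add (hg.norm.pow_const 2)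
        exact ((continuous_proj hne hc hv).measurable.comp
          (ih.fst.sub ((measurable_const.div hvm.sqrt).smul hg))).prodMk hvm
  dep t xs xs' h := by
    refine congrArg Prod.fst (?_ : adaGradIter Θ G a v₀ θ₁ xs t = adaGradIter Θ G a v₀ θ₁ xs' t)
    induction t with
    | zero => rfl
    | succ n ih =>
      cases n with
      | zero => rfl
      | succ n =>
        have ih := ih fun i h1 h2 => h i h1 (by omega)
        simp only [adaGradIter, ih, h (n + 2) (by omega) (by omega)]

theorem isAdapted_heavyBallIter (hne : Θ.Nonempty) (hc : IsCompact Θ) (hv : Convex ℝ Θ)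
    (hG : Measurable (Function.uncurry G)) (α : ℕ → ℝ) (β : ℝ) (z₁ : E) {θ₁ : E}
    (hθ₁ : θ₁ ∈ Θ) :
    IsAdapted Θ fun xs t => (heavyBallIter Θ G α β z₁ θ₁ xs t).1 where
  mem xs t := heavyBallIter_mem hne hc G α β z₁ hθ₁ xs t
  meas t := by
    refine Measurable.fst (?_ : Measurable fun xs => heavyBallIter Θ G α β z₁ θ₁ xs t)
    induction t with
    | zero => exact measurable_const
    | succ n ih =>
      cases n with
      | zero => exact measurable_const
      | succ n =>
        have hθ : Measurable fun xs : ℕ → X =>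
            proj Θ ((heavyBallIter Θ G α β z₁ θ₁ xs (n + 1)).1
              - α (n + 1) • (heavyBallIter Θ G α β z₁ θ₁ xs (n + 1)).2) :=
          (continuous_proj hne hc hv).measurable.comp (ih.fst.sub (ih.snd.const_smul _))
        exact hθ.prodMk (((hG.comp (hθ.prodMk (measurable_pi_apply (n + 2)))).const_smul β).add
          ((ih.fst.sub hθ).const_smul _))
  dep t xs xs' h := by
    refine congrArg Prod.fst
      (?_ : heavyBallIter Θ G α β z₁ θ₁ xs t = heavyBallIter Θ G α β z₁ θ₁ xs' t)
    induction t with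
    | zero => rfl
    | succ n ih =>
      cases n with
      | zero => rfl
      | succ n =>
        have ih := ih fun i h1 h2 => h i h1 (by omega)
        simp only [heavyBallIter, ih, h (n + 2) (by omega) (by omega)]

theorem Algorithm.isAdapted_iter (alg : Algorithm E) (hne : Θ.Nonempty) (hc : IsCompact Θ)
    (hv : Convex ℝ Θ) (hG : Measurable (Function.uncurry G)) {θ₁ : E} (hθ₁ : θ₁ ∈ Θ) :
    IsAdapted Θ (alg.iter Θ G θ₁) := by
  cases alg with
  | psgd c => exact isAdapted_psgdIter hne hc hv hG _ hθ₁
  | adaGrad a v₀ => exact isAdapted_adaGradIter hne hc hv hG a v₀ hθ₁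
  | heavyBall c β z₁ => exact isAdapted_heavyBallIter hne hc hv hG _ β z₁ hθ₁

end Iterates

/-! ### Signs and monotonicity of the selection weights. -/

section Weights

variable {E : Type*}

theorem Algorithm.Admissible.weight_nonneg {alg : Algorithm E} (h : alg.Admissible) (t : ℕ) :
    0 ≤ alg.weight t := by
  cases alg with
  | psgd c => exact stepSize_nonneg (le_of_lt h) t
  | adaGrad a v₀ => exact zero_le_one
  | heavyBall c β z₁ => exact stepSize_nonneg h.1.le t

theorem Algorithm.Admissible.weight_anti {alg : Algorithm E} (h : alg.Admissible) (s t : ℕ)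
    (hs : 1 ≤ s) (hst : s ≤ t) : alg.weight t ≤ alg.weight s := by
  cases alg with
  | psgd c => exact stepSize_anti (le_of_lt h) hs hst
  | adaGrad a v₀ => exact le_rfl
  | heavyBall c β z₁ => exact stepSize_anti h.1.le hs hst

theorem Algorithm.Admissible.weight_one_pos {alg : Algorithm E} (h : alg.Admissible) :
    0 < alg.weight 1 := by
  cases alg with
  | psgd c => exact div_pos h (by simp)
  | adaGrad a v₀ => exact zero_lt_one
  | heavyBall c β z₁ => exact div_pos h.1 (by simp)

end Weights

/-! ### Deterministic bounds along sample paths. -/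

section Paths

variable {E X : Type*} [NormedAddCommGroup E] [InnerProductSpace ℝ E] [CompleteSpace E]
  {f : E → ℝ} {Θ : Set E} {G : E → X → E} {ρ M L D : ℝ}

/-- Bounds along all sample paths for a process with weights `w`, whose stochastic gradient at
time `t` uses the sample `σ t`. -/
structure PathBound (f : E → ℝ) (Θ : Set E) (ρ : ℝ) (G : E → X → E) (w : ℕ → ℝ) (σ : ℕ → ℕ)
    (it : (ℕ → X) → ℕ → E) (κ : ℝ) : Prop where
  displacement : ∀ T : ℕ, 1 ≤ T → ∀ xs,
    ∑ t ∈ Finset.Icc 1 T, w t * ‖it xs (t + 1) - it xs t‖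
      ≤ κ * (1 + Real.log T) * ((∑ t ∈ Finset.Icc 1 T, w t) / √(T : ℝ))
  descent : ∀ T : ℕ, 1 ≤ T → ∀ xs,
    ∑ t ∈ Finset.Icc 1 T, w t * ⟪G (it xs t) (xs (σ t)), it xs t - prox f Θ ρ (it xs t)⟫
      ≤ κ * (1 + Real.log T) * ((∑ t ∈ Finset.Icc 1 T, w t) / √(T : ℝ))

/-- Displacements are at most `L α_t`, so their weighted sum is controlled by `∑ α_t²`, of order
`log T`. The descent terms telescope in the envelope, which stays in `[-M, M]`, with the same
second-order error. -/
theorem pathBound_psgd (h : SmoothOn f Θ ρ) (hM : ∀ θ ∈ Θ, |f θ| ≤ M) (hM0 : 0 ≤ M)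
    (hG : ∀ θ ∈ Θ, ∀ s, ‖G θ s‖ ≤ L) (hL : 0 ≤ L) {c : ℝ} (hc : 0 < c) {θ₁ : E} (hθ₁ : θ₁ ∈ Θ) :
    PathBound f Θ ρ G (stepSize c) (fun t => t + 1) (psgdIter Θ G (stepSize c) θ₁)
      ((M + L ^ 2 * c ^ 2 + L * c ^ 2) / c) := by
  have hρ := h.nonneg
  suffices hs : ∀ T : ℕ, 1 ≤ T → ∀ Q : ℝ, Q ≤ (M + L ^ 2 * c ^ 2 + L * c ^ 2) * (1 + Real.log T) →
      Q ≤ (M + L ^ 2 * c ^ 2 + L * c ^ 2) / c * (1 + Real.log T)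
        * ((∑ t ∈ Finset.Icc 1 T, stepSize c t) / √(T : ℝ)) by
    have hmem := fun xs t => psgdIter_mem h.nonempty h.compact G (stepSize c) hθ₁ xs t
    have hstep : ∀ (xs : ℕ → X) (t : ℕ), 1 ≤ t → psgdIter Θ G (stepSize c) θ₁ xs (t + 1)
        = proj Θ (psgdIter Θ G (stepSize c) θ₁ xs t
          - stepSize c t • G (psgdIter Θ G (stepSize c) θ₁ xs t) (xs (t + 1))) := by
      intro xs t ht
      obtain ⟨n, rfl⟩ : ∃ n, t = n + 1 := ⟨t - 1, by omega⟩
      rfl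
    refine ⟨fun T hT xs => hs T hT _ ?_, fun T hT xs => hs T hT _ ?_⟩
    all_goals
      have hlog : 0 ≤ Real.log T := Real.log_natCast_nonneg T
      have hsq := sum_Icc_stepSize_sq_le c T
    · calc ∑ t ∈ Finset.Icc 1 T, stepSize c t * ‖psgdIter Θ G (stepSize c) θ₁ xs (t + 1)
              - psgdIter Θ G (stepSize c) θ₁ xs t‖
          ≤ ∑ t ∈ Finset.Icc 1 T, L * stepSize c t ^ 2 := by
            refine Finset.sum_le_sum fun t ht => ?_
            have hα := stepSize_nonneg hc.le t
            have h1 := norm_proj_add_sub_le h.nonempty h.compact h.convex (hmem xs t)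
              (stepSize c t • G (psgdIter Θ G (stepSize c) θ₁ xs t) (xs (t + 1)))
            rw [← hstep xs t (Finset.mem_Icc.1 ht).1, norm_smul, Real.norm_of_nonneg hα] at h1
            have h2 := mul_le_mul_of_nonneg_left (hG _ (hmem xs t) (xs (t + 1))) hα
            have := mul_le_mul_of_nonneg_left (h1.trans h2) hα
            linarith
        _ = L * ∑ t ∈ Finset.Icc 1 T, stepSize c t ^ 2 := by rw [Finset.mul_sum]
        _ ≤ L * (c ^ 2 * (1 + Real.log T)) := by gcongr
        _ ≤ _ := by
            have : 0 ≤ (M + L ^ 2 * c ^ 2) * (1 + Real.log T) := by positivity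
            linarith
    · have h1 : 2 * ∑ t ∈ Finset.Icc 1 T, stepSize c t
          * ⟪G (psgdIter Θ G (stepSize c) θ₁ xs t) (xs (t + 1)),
            psgdIter Θ G (stepSize c) θ₁ xs t - prox f Θ ρ (psgdIter Θ G (stepSize c) θ₁ xs t)⟫
          ≤ ∑ t ∈ Finset.Icc 1 T, ((envelope f Θ ρ (psgdIter Θ G (stepSize c) θ₁ xs t)
              - envelope f Θ ρ (psgdIter Θ G (stepSize c) θ₁ xs (t + 1))) / (ρ + 1)
            + L ^ 2 * stepSize c t ^ 2) := by
        rw [Finset.mul_sum]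
        refine Finset.sum_le_sum fun t ht => ?_
        have hα := stepSize_nonneg hc.le t
        have h1 := h.envelope_proj_le (psgdIter Θ G (stepSize c) θ₁ xs t)
          (stepSize c t • G (psgdIter Θ G (stepSize c) θ₁ xs t) (xs (t + 1)))
        rw [← hstep xs t (Finset.mem_Icc.1 ht).1, inner_smul_left, norm_smul,
          Real.norm_of_nonneg hα, mul_pow, conj_trivial] at h1
        have h2 : ‖G (psgdIter Θ G (stepSize c) θ₁ xs t) (xs (t + 1))‖ ^ 2 ≤ L ^ 2 :=
          pow_le_pow_left₀ (norm_nonneg _) (hG _ (hmem xs t) _) 2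
        have h3 := mul_le_mul_of_nonneg_left h2 (sq_nonneg (stepSize c t))
        rw [← sub_le_iff_le_add, le_div_iff₀ (by positivity)]
        nlinarith
      rw [Finset.sum_add_distrib, ← Finset.sum_div,
        sum_Icc_sub_succ (fun t => envelope f Θ ρ (psgdIter Θ G (stepSize c) θ₁ xs t)),
        ← Finset.mul_sum] at h1
      have h2 := h.envelope_le_of_mem hM (hmem xs 1)
      have h3 := h.neg_le_envelope hM (psgdIter Θ G (stepSize c) θ₁ xs (T + 1))
      have h4 : (envelope f Θ ρ (psgdIter Θ G (stepSize c) θ₁ xs 1)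
          - envelope f Θ ρ (psgdIter Θ G (stepSize c) θ₁ xs (T + 1))) / (ρ + 1) ≤ 2 * M := by
        rw [div_le_iff₀ (by positivity)]
        nlinarith
      have h5 := mul_le_mul_of_nonneg_left hsq (sq_nonneg L)
      have h6 : 0 ≤ L * c ^ 2 * (1 + Real.log T) := by positivity
      have h7 : 0 ≤ M * Real.log T := by positivity
      have h8 : 0 ≤ L ^ 2 * (c ^ 2 * (1 + Real.log T)) := by positivity
      linarith
  intro T hT Q hQ
  have hlog : 0 ≤ Real.log T := Real.log_natCast_nonneg T
  have h1 := le_sum_stepSize_div_sqrt hc.le hT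
  refine hQ.trans ?_
  calc (M + L ^ 2 * c ^ 2 + L * c ^ 2) * (1 + Real.log T)
      = (M + L ^ 2 * c ^ 2 + L * c ^ 2) / c * (1 + Real.log T) * c := by field_simp
    _ ≤ _ := by gcongr

/-- Dividing the envelope inequality by the step size leaves increasing weights `√v_t / a`, so
summation by parts costs only the last weight, of order `√T`. The errors `‖g_t‖² / √v_t` and `‖g_t‖²
/ v_t` telescope against `2 √v` and `log v`. -/
theorem pathBound_adaGrad (h : SmoothOn f Θ ρ) (hM : ∀ θ ∈ Θ, |f θ| ≤ M) (hM0 : 0 ≤ M)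
    (hG : ∀ θ ∈ Θ, ∀ s, ‖G θ s‖ ≤ L) {a v₀ : ℝ} (ha : 0 < a) (hv₀ : 0 < v₀)
    {θ₁ : E} (hθ₁ : θ₁ ∈ Θ) :
    PathBound f Θ ρ G (fun _ => 1) (fun t => t + 1)
      (fun xs t => (adaGradIter Θ G a v₀ θ₁ xs t).1)
      (1 + a ^ 2 + a ^ 2 * Real.log ((v₀ + L ^ 2) / v₀) + (M / a + a) * √(v₀ + L ^ 2)) := by
  have hρ := h.nonneg
  have hmem := fun xs t => adaGradIter_mem h.nonempty h.compact G a v₀ hθ₁ xs t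
  set ℓ := Real.log ((v₀ + L ^ 2) / v₀) with hℓ
  have hℓ0 : 0 ≤ ℓ := Real.log_nonneg (by rw [le_div_iff₀ hv₀]; nlinarith [sq_nonneg L])
  have hW : ∀ T : ℕ, 1 ≤ T → (∑ _t ∈ Finset.Icc 1 T, (1 : ℝ)) / √(T : ℝ) = √(T : ℝ) :=
    fun T hT => by simp
  have main : ∀ (T : ℕ), 1 ≤ T → ∀ xs : ℕ → X,
      (∑ t ∈ Finset.Icc 1 T, ‖(adaGradIter Θ G a v₀ θ₁ xs (t + 1)).1
          - (adaGradIter Θ G a v₀ θ₁ xs t).1‖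
        ≤ √(T : ℝ) * (1 + a ^ 2 * (ℓ + Real.log T))) ∧
      (∑ t ∈ Finset.Icc 1 T, ⟪G (adaGradIter Θ G a v₀ θ₁ xs t).1 (xs (t + 1)),
          (adaGradIter Θ G a v₀ θ₁ xs t).1 - prox f Θ ρ (adaGradIter Θ G a v₀ θ₁ xs t).1⟫
        ≤ √(T : ℝ) * ((M / a + a) * √(v₀ + L ^ 2))) := by
    intro T hT xs
    have hT0 : (1 : ℝ) ≤ T := by exact_mod_cast hT
    set θ : ℕ → E := fun t => (adaGradIter Θ G a v₀ θ₁ xs t).1 with hθ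
    -- The state at time `t` stores `v_{t-1}`, so `V (t + 1)` is the `v_t` in the step from `θ t`.
    set V : ℕ → ℝ := fun t => (adaGradIter Θ G a v₀ θ₁ xs t).2 with hV
    set g : ℕ → E := fun t => G (θ t) (xs (t + 1)) with hg
    have hVs : ∀ t, 1 ≤ t → V (t + 1) = V t + ‖g t‖ ^ 2 := fun t ht => by
      obtain ⟨n, rfl⟩ : ∃ n, t = n + 1 := ⟨t - 1, by omega⟩
      rfl
    have hθs : ∀ t, 1 ≤ t → θ (t + 1) = proj Θ (θ t - (a / √(V (t + 1))) • g t) := fun t ht => by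
      obtain ⟨n, rfl⟩ : ∃ n, t = n + 1 := ⟨t - 1, by omega⟩
      rfl
    have hV01 : V 0 = v₀ ∧ V 1 = v₀ := ⟨rfl, rfl⟩
    have hVmono : Monotone V := monotone_nat_of_le_succ fun t => by
      rcases Nat.eq_zero_or_pos t with rfl | ht
      · rw [hV01.1, zero_add, hV01.2]
      · rw [hVs t ht]; nlinarith [sq_nonneg ‖g t‖]
    have hVpos : ∀ t, 0 < V t := fun t =>
      hv₀.trans_le (by rw [← hV01.1]; exact hVmono (Nat.zero_le t))
    have hgL : ∀ t, ‖g t‖ ^ 2 ≤ L ^ 2 := fun t =>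
      pow_le_pow_left₀ (norm_nonneg _) (hG _ (hmem xs t) _) 2
    have hVT : V (T + 1) ≤ (v₀ + L ^ 2) * T := by
      have : ∀ n : ℕ, V (n + 1) ≤ v₀ + n * L ^ 2 := fun n => by
        induction n with
        | zero => simp [hV01.2]
        | succ n ih =>
          rw [hVs (n + 1) (by omega)]
          have := hgL (n + 1)
          push_cast
          linarith
      have h1 := this T
      nlinarith
    have hsqrtVT : √(V (T + 1)) ≤ √(v₀ + L ^ 2) * √(T : ℝ) := by
      rw [← Real.sqrt_mul (by positivity)]
      exact Real.sqrt_le_sqrt hVT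
    constructor
    · have hlogsum : ∀ n : ℕ, ∑ t ∈ Finset.Icc 1 n, ‖g t‖ ^ 2 / V (t + 1)
          ≤ Real.log (V (n + 1)) - Real.log v₀ := fun n => by
        induction n with
        | zero => simp [hV01.2]
        | succ n ih =>
          rw [Finset.sum_Icc_succ_top (by omega)]
          have h1 := Real.log_le_sub_one_of_pos (div_pos (hVpos (n + 1)) (hVpos (n + 1 + 1)))
          rw [Real.log_div (hVpos _).ne' (hVpos _).ne'] at h1
          have h2 : V (n + 1) / V (n + 1 + 1) - 1 = -(‖g (n + 1)‖ ^ 2 / V (n + 1 + 1)) := by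
            have := (hVpos (n + 1 + 1)).ne'
            field_simp
            rw [hVs (n + 1) (by omega)]; ring
          linarith
      have hlogT : Real.log (V (T + 1)) - Real.log v₀ ≤ ℓ + Real.log T := by
        rw [hℓ, Real.log_div (by positivity) hv₀.ne']
        have := Real.log_le_log (hVpos _) hVT
        rw [Real.log_mul (by positivity) (by positivity)] at this
        linarith
      have hsT : 0 < √(T : ℝ) := Real.sqrt_pos.2 (by linarith)
      -- Young's inequality with weight `√T` balances `T` copies of `1 / √T` against `√T` times a
      -- logarithmic sum of squares.
      have hδ : ∀ t ∈ Finset.Icc 1 T, ‖θ (t + 1) - θ t‖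
          ≤ (√(T : ℝ))⁻¹ + √(T : ℝ) * (a ^ 2 * (‖g t‖ ^ 2 / V (t + 1))) := fun t ht => by
        have h1 := norm_proj_add_sub_le h.nonempty h.compact h.convex (hmem xs t)
          ((a / √(V (t + 1))) • g t)
        rw [← hθs t (Finset.mem_Icc.1 ht).1, norm_smul, Real.norm_of_nonneg (by positivity)] at h1
        refine h1.trans ?_
        set b := a / √(V (t + 1)) * ‖g t‖ with hb
        have h2 : a ^ 2 * (‖g t‖ ^ 2 / V (t + 1)) = b ^ 2 := by
          rw [hb, mul_pow, div_pow, Real.sq_sqrt (hVpos _).le]; ring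
        rw [h2]
        have h3 : (√(T : ℝ))⁻¹ * √(T : ℝ) = 1 := inv_mul_cancel₀ hsT.ne'
        have h4 : 0 ≤ √(T : ℝ) * (b - (√(T : ℝ))⁻¹) ^ 2 := by positivity
        have h5 : √(T : ℝ) * (b - (√(T : ℝ))⁻¹) ^ 2
            = √(T : ℝ) * b ^ 2 - 2 * b * ((√(T : ℝ))⁻¹ * √(T : ℝ))
              + ((√(T : ℝ))⁻¹ * √(T : ℝ)) * (√(T : ℝ))⁻¹ := by ring
        rw [h5, h3] at h4
        have h6 : 0 ≤ b := by positivity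
        linarith
      refine (Finset.sum_le_sum hδ).trans ?_
      rw [Finset.sum_add_distrib, ← Finset.mul_sum, ← Finset.mul_sum]
      have h1 : ∑ _t ∈ Finset.Icc 1 T, (√(T : ℝ))⁻¹ = √(T : ℝ) := by
        simp only [Finset.sum_const, Nat.card_Icc, add_tsub_cancel_right, nsmul_eq_mul]
        rw [← div_eq_mul_inv, Real.div_sqrt]
      rw [h1, mul_add, mul_one]
      gcongr
      exact (hlogsum T).trans hlogT
    · have hsqsum : ∀ n : ℕ, ∑ t ∈ Finset.Icc 1 n, ‖g t‖ ^ 2 / √(V (t + 1))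
          ≤ 2 * √(V (n + 1)) := fun n => by
        induction n with
        | zero => simp
        | succ n ih =>
          rw [Finset.sum_Icc_succ_top (by omega)]
          have h1 : ‖g (n + 1)‖ ^ 2 / √(V (n + 1 + 1))
              ≤ 2 * √(V (n + 1 + 1)) - 2 * √(V (n + 1)) := by
            rw [div_le_iff₀ (Real.sqrt_pos.2 (hVpos _))]
            have h2 := hVs (n + 1) (by omega)
            have h3 := Real.sq_sqrt (hVpos (n + 1)).le
            have h4 := Real.sq_sqrt (hVpos (n + 1 + 1)).le
            nlinarith [sq_nonneg (√(V (n + 1 + 1)) - √(V (n + 1)))]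
          linarith
      set b : ℕ → ℝ := fun t => √(V (t + 1)) / a with hb
      have hbmono : Monotone b := fun s t hst => by
        simp only [hb]
        have := hVmono (Nat.succ_le_succ hst)
        gcongr
      have hF : ∀ t, envelope f Θ ρ (θ t) ≤ M := fun t => h.envelope_le_of_mem hM (hmem xs t)
      have habel := sum_mul_sub_succ_le (b := b) (F := fun t => envelope f Θ ρ (θ t))
        (by positivity) hbmono hF T
      have hFT := h.neg_le_envelope hM (θ (T + 1))
      have hterm : ∀ t ∈ Finset.Icc 1 T, ⟪g t, θ t - prox f Θ ρ (θ t)⟫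
          ≤ (2 * (ρ + 1))⁻¹ * (b t * (envelope f Θ ρ (θ t) - envelope f Θ ρ (θ (t + 1))))
            + a / 2 * (‖g t‖ ^ 2 / √(V (t + 1))) := fun t ht => by
        have hs := Real.sqrt_pos.2 (hVpos (t + 1))
        have h1 := h.envelope_proj_le (θ t) ((a / √(V (t + 1))) • g t)
        rw [← hθs t (Finset.mem_Icc.1 ht).1, inner_smul_left, norm_smul,
          Real.norm_of_nonneg (by positivity), mul_pow, conj_trivial] at h1
        simp only [hb]
        set s := √(V (t + 1))
        set I := ⟪g t, θ t - prox f Θ ρ (θ t)⟫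
        set F := envelope f Θ ρ (θ t)
        set F' := envelope f Θ ρ (θ (t + 1))
        have hpos : 0 ≤ s / a / (2 * (ρ + 1)) := by positivity
        have h2 := mul_le_mul_of_nonneg_left h1 hpos
        have e1 : s / a / (2 * (ρ + 1))
            * (F + (ρ + 1) * ((a / s) ^ 2 * ‖g t‖ ^ 2 - 2 * (a / s * I)))
            = (2 * (ρ + 1))⁻¹ * (s / a * F) + a / 2 * (‖g t‖ ^ 2 / s) - I := by
          field_simp
          ring
        have e2 : s / a / (2 * (ρ + 1)) * F' = (2 * (ρ + 1))⁻¹ * (s / a * F') := by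
          field_simp
        rw [e1, e2] at h2
        linarith
      refine (Finset.sum_le_sum hterm).trans ?_
      rw [Finset.sum_add_distrib, ← Finset.mul_sum, ← Finset.mul_sum]
      have h1 : (2 * (ρ + 1))⁻¹ * ∑ t ∈ Finset.Icc 1 T,
          b t * (envelope f Θ ρ (θ t) - envelope f Θ ρ (θ (t + 1)))
          ≤ M / a * √(V (T + 1)) := by
        rw [inv_mul_le_iff₀ (by positivity)]
        have hbT : 0 ≤ b T := by positivity
        have h2 : b T * (M - envelope f Θ ρ (θ (T + 1))) ≤ b T * (2 * M) := by
          gcongr; linarith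
        have h3 : M / a * √(V (T + 1)) = b T * M := by simp only [hb]; ring
        rw [h3]
        have h4 : 0 ≤ ρ * (b T * M) := by positivity
        linarith
      have h2 : a / 2 * ∑ t ∈ Finset.Icc 1 T, ‖g t‖ ^ 2 / √(V (t + 1)) ≤ a * √(V (T + 1)) := by
        have := mul_le_mul_of_nonneg_left (hsqsum T) (by positivity : 0 ≤ a / 2)
        linarith
      calc _ ≤ (M / a + a) * √(V (T + 1)) := by linarith
        _ ≤ (M / a + a) * (√(v₀ + L ^ 2) * √(T : ℝ)) := by gcongr
        _ = _ := by ring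
  have hfin : ∀ T : ℕ, 1 ≤ T → 0 ≤ Real.log T := fun T _ => Real.log_natCast_nonneg T
  refine ⟨fun T hT xs => ?_, fun T hT xs => ?_⟩
  · rw [hW T hT]
    simp only [one_mul]
    refine (main T hT xs).1.trans ?_
    rw [mul_comm]
    have h0 := hfin T hT
    have h2 : 0 ≤ (M / a + a) * √(v₀ + L ^ 2) := by positivity
    refine mul_le_mul_of_nonneg_right ?_ (Real.sqrt_nonneg _)
    have h3 : 0 ≤ (M / a + a) * √(v₀ + L ^ 2) * (1 + Real.log T) := by positivity
    have h4 : 0 ≤ a ^ 2 * ℓ * Real.log T := by positivity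
    nlinarith [sq_nonneg a]
  · rw [hW T hT]
    simp only [one_mul]
    refine (main T hT xs).2.trans ?_
    rw [mul_comm]
    have h0 := hfin T hT
    have h2 : 0 ≤ (M / a + a) * √(v₀ + L ^ 2) := by positivity
    refine mul_le_mul_of_nonneg_right ?_ (Real.sqrt_nonneg _)
    have h3 : 0 ≤ (M / a + a) * √(v₀ + L ^ 2) * Real.log T := by positivity
    have h4 : 0 ≤ (1 + a ^ 2 + a ^ 2 * ℓ) * (1 + Real.log T) := by positivity
    linarith

/-- The envelope telescopes at the extrapolated points, with errors `α_t²` and squared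
displacements. By convexity the latter obey a recursion contracting by `1 - β` and driven by `β L²
α_t²`, so their sum is also of order `1 + log T`. The arbitrary `z₁` affects only the first step,
which is bounded by the diameter. -/
theorem pathBound_heavyBall (h : SmoothOn f Θ ρ) (hM : ∀ θ ∈ Θ, |f θ| ≤ M) (hM0 : 0 ≤ M)
    (hG : ∀ θ ∈ Θ, ∀ s, ‖G θ s‖ ≤ L) (hL : 0 ≤ L) (hD : ∀ a ∈ Θ, ∀ b ∈ Θ, ‖a - b‖ ≤ D)
    {c β : ℝ} (hc : 0 < c) (hβ0 : 0 < β) (hβ1 : β ≤ 1) (z₁ : E) {θ₁ : E} (hθ₁ : θ₁ ∈ Θ) :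
    PathBound f Θ ρ G (stepSize c) (fun t => t)
      (fun xs t => (heavyBallIter Θ G (stepSize c) β z₁ θ₁ xs t).1)
      ((c * L * D + M + β⁻¹ ^ 2 * D ^ 2 + (L ^ 2 + 1) * c ^ 2
        + (10 * β⁻¹ ^ 2 + 1) * (β⁻¹ * D ^ 2 + β⁻¹ * L ^ 2 * c ^ 2)) / c) := by
  have hρ := h.nonneg
  set α := stepSize c with hαdef
  have hD0 : 0 ≤ D := (norm_nonneg _).trans (hD θ₁ hθ₁ θ₁ hθ₁)
  set m := β⁻¹ with hm
  have hm0 : 0 < m := inv_pos.2 hβ0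
  have hm1 : β * m = 1 := mul_inv_cancel₀ hβ0.ne'
  set K₁ := c * L * D + M + m ^ 2 * D ^ 2 + (L ^ 2 + 1) * c ^ 2
        + (10 * m ^ 2 + 1) * (m * D ^ 2 + m * L ^ 2 * c ^ 2) with hK₁
  have hK₁0 : 0 ≤ K₁ := by positivity
  suffices hs : ∀ T : ℕ, 1 ≤ T → ∀ xs : ℕ → X,
      (∑ t ∈ Finset.Icc 1 T, α t * ‖(heavyBallIter Θ G α β z₁ θ₁ xs (t + 1)).1
          - (heavyBallIter Θ G α β z₁ θ₁ xs t).1‖ ≤ K₁ * (1 + Real.log T)) ∧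
      (∑ t ∈ Finset.Icc 1 T, α t * ⟪G (heavyBallIter Θ G α β z₁ θ₁ xs t).1 (xs t),
          (heavyBallIter Θ G α β z₁ θ₁ xs t).1
            - prox f Θ ρ (heavyBallIter Θ G α β z₁ θ₁ xs t).1⟫ ≤ K₁ * (1 + Real.log T)) by
    have hup : ∀ T : ℕ, 1 ≤ T → K₁ * (1 + Real.log T)
        ≤ K₁ / c * (1 + Real.log T) * ((∑ t ∈ Finset.Icc 1 T, α t) / √(T : ℝ)) := fun T hT => by
      have h1 := le_sum_stepSize_div_sqrt hc.le hT
      have hlog : 0 ≤ Real.log T := Real.log_natCast_nonneg T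
      calc K₁ * (1 + Real.log T) = K₁ / c * (1 + Real.log T) * c := by field_simp
        _ ≤ _ := by gcongr
    exact ⟨fun T hT xs => (hs T hT xs).1.trans (hup T hT),
      fun T hT xs => (hs T hT xs).2.trans (hup T hT)⟩
  intro T hT xs
  set θ : ℕ → E := fun t => (heavyBallIter Θ G α β z₁ θ₁ xs t).1 with hθ
  set z : ℕ → E := fun t => (heavyBallIter Θ G α β z₁ θ₁ xs t).2 with hz
  have hmem : ∀ t, θ t ∈ Θ := fun t => heavyBallIter_mem h.nonempty h.compact G α β z₁ hθ₁ xs t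
  set d : ℕ → E := fun t => θ (t + 1) - θ t with hd
  have hα0 : ∀ t, 0 ≤ α t := fun t => stepSize_nonneg hc.le t
  have hαpos : ∀ t, 1 ≤ t → 0 < α t := fun t ht => by
    have : (0 : ℝ) < t := by exact_mod_cast ht
    simp only [hαdef, stepSize]; positivity
  have hstep : ∀ n, θ (n + 3) = proj Θ (θ (n + 2)
      - ((β * α (n + 2)) • G (θ (n + 2)) (xs (n + 2)) - (1 - β) • d (n + 1))) := fun n => by
    have h1 : θ (n + 3) = proj Θ (θ (n + 2) - α (n + 2) • z (n + 2)) := rfl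
    have h2 : z (n + 2) = β • G (θ (n + 2)) (xs (n + 2))
        + ((1 - β) / α (n + 2)) • (θ (n + 1) - θ (n + 2)) := rfl
    rw [h1, h2, smul_add, smul_smul, smul_smul, mul_div_cancel₀ _ (hαpos (n + 2) (by omega)).ne',
      mul_comm (α (n + 2)) β, ← neg_sub (θ (n + 2)) (θ (n + 1)), smul_neg, ← sub_eq_add_neg]
  have hdnext : ∀ n, ‖d (n + 2)‖ ^ 2
      ≤ (1 - β) * ‖d (n + 1)‖ ^ 2 + β * (L ^ 2 * α (n + 2) ^ 2) := fun n => by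
    have h1 := norm_proj_add_sub_le h.nonempty h.compact h.convex (hmem (n + 2))
      ((β * α (n + 2)) • G (θ (n + 2)) (xs (n + 2)) - (1 - β) • d (n + 1))
    rw [← hstep n] at h1
    have h2 := norm_sub_le ((β * α (n + 2)) • G (θ (n + 2)) (xs (n + 2))) ((1 - β) • d (n + 1))
    have hα := hα0 (n + 2)
    rw [norm_smul, norm_smul, Real.norm_of_nonneg (by positivity),
      Real.norm_of_nonneg (by linarith : 0 ≤ 1 - β)] at h2
    have h3 := mul_le_mul_of_nonneg_left (hG _ (hmem (n + 2)) (xs (n + 2)))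
      (by positivity : 0 ≤ β * α (n + 2))
    have h4 : ‖d (n + 2)‖ ≤ β * (L * α (n + 2)) + (1 - β) * ‖d (n + 1)‖ := by
      have : ‖d (n + 2)‖ ≤ _ := h1.trans h2
      linarith
    have h5 : ‖d (n + 2)‖ ^ 2 ≤ (β * (L * α (n + 2)) + (1 - β) * ‖d (n + 1)‖) ^ 2 := by gcongr
    have h6 : 0 ≤ β * (1 - β) * (L * α (n + 2) - ‖d (n + 1)‖) ^ 2 :=
      mul_nonneg (mul_nonneg hβ0.le (by linarith)) (sq_nonneg _)
    nlinarith
  have hsp : ∀ (n : ℕ) (F : ℕ → ℝ), ∑ t ∈ Finset.Icc 1 (n + 1 + 1), F t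
      = ∑ t ∈ Finset.Icc 1 (n + 1), F t + F (n + 2) := fun n F =>
    Finset.sum_Icc_succ_top (by omega) F
  have hSd : ∀ n : ℕ, β * ∑ t ∈ Finset.Icc 1 (n + 1), ‖d t‖ ^ 2 + (1 - β) * ‖d (n + 1)‖ ^ 2
      ≤ D ^ 2 + L ^ 2 * ∑ t ∈ Finset.Icc 1 (n + 1), α t ^ 2 := fun n => by
    induction n with
    | zero =>
      have h1 : ‖d 1‖ ^ 2 ≤ D ^ 2 := pow_le_pow_left₀ (norm_nonneg _) (hD _ (hmem 2) _ (hmem 1)) 2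
      have h2 : 0 ≤ L ^ 2 * α 1 ^ 2 := by positivity
      simp only [zero_add, Finset.Icc_self, Finset.sum_singleton]
      linarith
    | succ n ih =>
      rw [hsp, hsp]
      have h1 := hdnext n
      have h2 : 0 ≤ (1 - β) * (L ^ 2 * α (n + 2) ^ 2) :=
        mul_nonneg (by linarith) (by positivity)
      linarith
  have hlog : 0 ≤ Real.log T := Real.log_natCast_nonneg T
  have hA := sum_Icc_stepSize_sq_le c T
  rw [← hαdef] at hA
  set A := ∑ t ∈ Finset.Icc 1 T, α t ^ 2 with hAdef
  set Q := ∑ t ∈ Finset.Icc 1 T, ‖d t‖ ^ 2 with hQdef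
  obtain ⟨n, rfl⟩ : ∃ n, T = n + 1 := ⟨T - 1, by omega⟩
  set lT := 1 + Real.log ((n + 1 : ℕ) : ℝ) with hlT
  have hlT1 : 1 ≤ lT := by linarith
  have hQ : Q ≤ (m * D ^ 2 + m * L ^ 2 * c ^ 2) * lT := by
    have h1 := hSd n
    rw [← hQdef, ← hAdef] at h1
    have h2 : 0 ≤ (1 - β) * ‖d (n + 1)‖ ^ 2 := mul_nonneg (by linarith) (sq_nonneg _)
    have h3 : β * Q ≤ D ^ 2 + L ^ 2 * (c ^ 2 * lT) := by
      have := mul_le_mul_of_nonneg_left hA (sq_nonneg L)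
      linarith
    have h4 := mul_le_mul_of_nonneg_left h3 hm0.le
    rw [← mul_assoc, mul_comm m β, hm1, one_mul] at h4
    have h5 : m * D ^ 2 * 1 ≤ m * D ^ 2 * lT := by gcongr
    linarith
  have hQ0 : 0 ≤ Q := Finset.sum_nonneg fun _ _ => sq_nonneg _
  constructor
  · have h1 : ∑ t ∈ Finset.Icc 1 (n + 1), α t * ‖d t‖ ≤ A + Q := by
      rw [hAdef, hQdef, ← Finset.sum_add_distrib]
      refine Finset.sum_le_sum fun t _ => ?_
      nlinarith [sq_nonneg (α t - ‖d t‖), sq_nonneg (α t), sq_nonneg ‖d t‖]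
    refine h1.trans ((add_le_add hA hQ).trans ?_)
    have h2 : 0 ≤ (c * L * D + M + m ^ 2 * D ^ 2 + L ^ 2 * c ^ 2
        + 10 * m ^ 2 * (m * D ^ 2 + m * L ^ 2 * c ^ 2)) * lT := by positivity
    rw [hK₁]
    linarith
  · set l := (1 - β) / β with hl
    have hl0 : 0 ≤ l := div_nonneg (by linarith) hβ0.le
    have hlm : l ≤ m := by
      rw [hl, hm, ← one_div]
      gcongr
      linarith
    set I : ℕ → ℝ := fun t => α t * ⟪G (θ t) (xs t), θ t - prox f Θ ρ (θ t)⟫ with hI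
    have hdiam : ∀ t, ‖d t‖ ≤ D := fun t => hD _ (hmem _) _ (hmem _)
    -- Each displacement is charged twice, as `p` and then as `q`, hence `20`; the last has not yet
    -- served as `q`, hence the correction `-10`.
    have hind : ∀ n : ℕ, 2 * (ρ + 1) * ∑ t ∈ Finset.Icc 1 (n + 1), I t
        + envelope f Θ ρ (θ (n + 2) + l • d (n + 1))
        ≤ 2 * (ρ + 1) * (c * L * D) + M + (ρ + 1) * (m ^ 2 * D ^ 2)
          + (ρ + 1) * (2 * L ^ 2 * ∑ t ∈ Finset.Icc 1 (n + 1), α t ^ 2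
            + 20 * m ^ 2 * ∑ t ∈ Finset.Icc 1 (n + 1), ‖d t‖ ^ 2
            - 10 * m ^ 2 * ‖d (n + 1)‖ ^ 2) := fun n => by
      induction n with
      | zero =>
        simp only [zero_add, Finset.Icc_self, Finset.sum_singleton]
        have h1 : I 1 ≤ c * L * D := by
          have h2 := (real_inner_le_norm (G (θ 1) (xs 1)) (θ 1 - prox f Θ ρ (θ 1))).trans
            (mul_le_mul (hG _ (hmem 1) _) (hD _ (hmem 1) _ (h.prox_mem _)) (norm_nonneg _) hL)
          have h3 : α 1 = c := by simp [hαdef, stepSize]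
          simp only [hI, h3]
          have := mul_le_mul_of_nonneg_left h2 hc.le
          linarith
        have h2 := h.envelope_le (θ 2 + l • d 1) (hmem 2)
        rw [sub_add_cancel_left, norm_neg, norm_smul, Real.norm_of_nonneg hl0] at h2
        have h3 : (l * ‖d 1‖) ^ 2 ≤ (m * D) ^ 2 :=
          pow_le_pow_left₀ (by positivity) (mul_le_mul hlm (hdiam 1) (norm_nonneg _) hm0.le) 2
        have h4 := (abs_le.1 (hM _ (hmem 2))).2
        have h5 : 0 ≤ (ρ + 1) * (2 * L ^ 2 * α 1 ^ 2 + 10 * m ^ 2 * ‖d 1‖ ^ 2) := by positivity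
        have h6 := mul_le_mul_of_nonneg_left h1 (by positivity : 0 ≤ 2 * (ρ + 1))
        have h7 := mul_le_mul_of_nonneg_left h3 (by positivity : 0 ≤ ρ + 1)
        linarith
      | succ n ih =>
        rw [hsp, hsp, hsp]
        have h1 := h.envelope_heavyBall_le hL (hα0 (n + 2)) hβ0 hβ1 (θ := θ (n + 2))
          (q := d (n + 1)) (hG _ (hmem (n + 2)) (xs (n + 2))) (p := d (n + 2))
          (by rw [← hstep n])
        have h2 : θ (n + 2) + d (n + 2) = θ (n + 3) := by simp only [hd]; abel
        rw [h2, ← hl, ← hm] at h1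
        change envelope f Θ ρ (θ (n + 3) + l • d (n + 2)) ≤ _ + (ρ + 1) * (_ + _ - 2 * I (n + 2))
          at h1
        change 2 * (ρ + 1) * (_ + I (n + 2)) + envelope f Θ ρ (θ (n + 3) + l • d (n + 2)) ≤ _
        linarith
    have h1 := hind n
    rw [← hAdef, ← hQdef] at h1
    have h2 := h.neg_le_envelope hM (θ (n + 2) + l • d (n + 1))
    change ∑ t ∈ Finset.Icc 1 (n + 1), I t ≤ _
    set W := ∑ t ∈ Finset.Icc 1 (n + 1), I t
    have h3 : 0 ≤ (ρ + 1) * (10 * m ^ 2 * ‖d (n + 1)‖ ^ 2) := by positivity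
    have h4 : (2 * (ρ + 1)) * W ≤ (2 * (ρ + 1)) *
        (c * L * D + M + m ^ 2 * D ^ 2 + L ^ 2 * A + 10 * m ^ 2 * Q) := by
      have h5 : 0 ≤ ρ * M := by positivity
      have h6 : 0 ≤ (ρ + 1) * (m ^ 2 * D ^ 2) := by positivity
      linarith
    refine (le_of_mul_le_mul_left h4 (by positivity)).trans ?_
    have h5 := mul_le_mul_of_nonneg_left hA (sq_nonneg L)
    have h6 := mul_le_mul_of_nonneg_left hQ (by positivity : 0 ≤ 10 * m ^ 2)
    have h7 : (c * L * D + M + m ^ 2 * D ^ 2) * 1 ≤ (c * L * D + M + m ^ 2 * D ^ 2) * lT := by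
      gcongr
    have h8 : 0 ≤ (c ^ 2 + (m * D ^ 2 + m * L ^ 2 * c ^ 2)) * lT := by positivity
    rw [hK₁]
    linarith

/-- The three algorithms satisfy the path bounds, uniformly in the initial point. -/
theorem Algorithm.Admissible.exists_pathBound {alg : Algorithm E} (halg : alg.Admissible)
    (h : SmoothOn f Θ ρ) (hG : ∀ θ ∈ Θ, ∀ s, ‖G θ s‖ ≤ L) (hL : 0 ≤ L) :
    ∃ κ : ℝ, 0 ≤ κ ∧ ∃ σ : ℕ → ℕ, (∀ t, t ≤ σ t) ∧
      (∀ θ₁ ∈ Θ, PathBound f Θ ρ G alg.weight σ (alg.iter Θ G θ₁) κ) ∧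
      ∀ T : ℕ, 1 ≤ T → alg.weight 1 ≤ (∑ t ∈ Finset.Icc 1 T, alg.weight t) / √(T : ℝ) := by
  obtain ⟨M, hM0, hM⟩ := h.exists_abs_le
  obtain ⟨D, hD0, hD⟩ := h.exists_norm_sub_le
  have hw1 : ∀ c : ℝ, stepSize c 1 = c := fun c => by simp [stepSize]
  cases alg with
  | psgd c =>
    have hc : 0 < c := halg
    refine ⟨_, ?_, _, fun t => Nat.le_succ t,
      fun θ₁ hθ₁ => pathBound_psgd h hM hM0 hG hL hc hθ₁, fun T hT => ?_⟩
    · positivity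
    · change stepSize c 1 ≤ _
      rw [hw1]
      exact le_sum_stepSize_div_sqrt hc.le hT
  | adaGrad a v₀ =>
    obtain ⟨ha, hv₀⟩ : 0 < a ∧ 0 < v₀ := halg
    refine ⟨_, ?_, _, fun t => Nat.le_succ t,
      fun θ₁ hθ₁ => pathBound_adaGrad h hM hM0 hG ha hv₀ hθ₁, fun T hT => ?_⟩
    · have : 0 ≤ Real.log ((v₀ + L ^ 2) / v₀) :=
        Real.log_nonneg (by rw [le_div_iff₀ hv₀]; nlinarith [sq_nonneg L])
      positivity
    · have hT0 : (1 : ℝ) ≤ T := by exact_mod_cast hT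
      simp [weight, hT0]
  | heavyBall c β z₁ =>
    obtain ⟨hc, hβ0, hβ1⟩ : 0 < c ∧ 0 < β ∧ β ≤ 1 := halg
    refine ⟨_, ?_, _, fun t => le_rfl,
      fun θ₁ hθ₁ => pathBound_heavyBall h hM hM0 hG hL hD hc hβ0 hβ1 z₁ hθ₁, fun T hT => ?_⟩
    · positivity
    · change stepSize c 1 ≤ _
      rw [hw1]
      exact le_sum_stepSize_div_sqrt hc.le hT

end Paths

/-! ### The lag and the number of iterations. -/

section Scalar

/-- A logarithmic number of steps makes a geometric factor smaller than `1 / T`. -/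
theorem exists_lag {r : ℝ} (hr₀ : 0 < r) (hr₁ : r < 1) {T : ℕ} (hT : 1 ≤ T) :
    ∃ k : ℕ, 1 ≤ k ∧ (k : ℝ) ≤ ((Real.log r⁻¹)⁻¹ + 2) * (1 + Real.log T) ∧
      r ^ k ≤ (T : ℝ)⁻¹ := by
  have hT0 : (0 : ℝ) < T := by exact_mod_cast hT
  have hlr : 0 < Real.log r⁻¹ := Real.log_pos ((one_lt_inv₀ hr₀).2 hr₁)
  have hlT : 0 ≤ Real.log T := Real.log_natCast_nonneg T
  -- The extra one keeps the lag positive at `T = 1`.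
  refine ⟨⌈Real.log T / Real.log r⁻¹⌉₊ + 1, by omega, ?_, ?_⟩
  · have h1 := (Nat.ceil_lt_add_one (div_nonneg hlT hlr.le)).le
    have h2 : Real.log T / Real.log r⁻¹ = (Real.log r⁻¹)⁻¹ * Real.log T := by ring
    have h3 := inv_pos.2 hlr
    push_cast
    nlinarith
  · refine (pow_le_pow_of_le_one hr₀.le hr₁.le (Nat.le_succ _)).trans ?_
    rw [← Real.log_le_log_iff (by positivity) (by positivity), Real.log_pow, Real.log_inv]
    have h1 := Nat.le_ceil (Real.log T / Real.log r⁻¹)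
    rw [div_le_iff₀ hlr] at h1
    rw [Real.log_inv] at h1 ⊢
    linarith

/-- The logarithm is eventually below any small multiple of `B^(1/4)`, whose square is `√B`. Using
`K + 1` allows `K = 0`. -/
theorem exists_forall_mul_log_sq_le_sqrt (K : ℝ) (hK : 0 ≤ K) :
    ∃ A : ℝ, 1 ≤ A ∧ ∀ B : ℝ, A ≤ B → K * (9 + Real.log B) ^ 2 ≤ √B := by
  set c : ℝ := (2 * (K + 1))⁻¹ with hc
  have hc0 : 0 < c := by positivity
  have h1 := (isLittleO_log_rpow_atTop (by norm_num : (0 : ℝ) < 1 / 4)).bound hc0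
  have h2 := (tendsto_rpow_atTop (by norm_num : (0 : ℝ) < 1 / 4)).eventually_ge_atTop (9 / c)
  obtain ⟨A, hA⟩ := Filter.eventually_atTop.1 (h1.and h2)
  refine ⟨max A 1, le_max_right _ _, fun B hB => ?_⟩
  have hB1 : 1 ≤ B := (le_max_right _ _).trans hB
  obtain ⟨h3, h4⟩ := hA B ((le_max_left _ _).trans hB)
  have hlog : 0 ≤ Real.log B := Real.log_nonneg hB1
  set s := B ^ (1 / 4 : ℝ) with hs
  have hs0 : 0 ≤ s := by positivity
  have hs2 : √B = s ^ 2 := by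
    rw [Real.sqrt_eq_rpow, hs, ← Real.rpow_natCast, ← Real.rpow_mul (by linarith)]
    norm_num
  rw [Real.norm_of_nonneg hlog, Real.norm_of_nonneg hs0] at h3
  rw [div_le_iff₀ hc0] at h4
  have h5 : 9 + Real.log B ≤ (K + 1)⁻¹ * s := by
    have : (K + 1)⁻¹ = 2 * c := by rw [hc]; field_simp
    rw [this]; linarith
  rw [hs2]
  calc K * (9 + Real.log B) ^ 2 ≤ (K + 1) * ((K + 1)⁻¹ * s) ^ 2 := by
        gcongr
        linarith
    _ = (K + 1)⁻¹ * s ^ 2 := by field_simp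
    _ ≤ 1 * s ^ 2 := by
        gcongr
        exact inv_le_one_of_one_le₀ (by linarith)
    _ = s ^ 2 := one_mul _

/-- The number of iterations, of order `ε⁻⁴` up to logarithms, after which a rate of
`(1 + log T)² / √T` falls below `ε²`. -/
theorem exists_threshold (K : ℝ) (hK : 0 ≤ K) :
    ∃ A : ℝ, 1 ≤ A ∧ ∀ ε : ℝ, 0 < ε → ε ≤ 1 → ∀ T : ℝ,
      A * ε⁻¹ ^ 4 * (1 + Real.log ε⁻¹) ^ 4 ≤ T →
      K * ((1 + Real.log T) ^ 2 / √T) ≤ ε ^ 2 := by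
  obtain ⟨A, hA1, hA⟩ := exists_forall_mul_log_sq_le_sqrt K hK
  refine ⟨A, hA1, fun ε hε hε1 T hT => ?_⟩
  have hi : 1 ≤ ε⁻¹ := (one_le_inv₀ hε).2 hε1
  have hl0 : 0 ≤ Real.log ε⁻¹ := Real.log_nonneg hi
  set l := 1 + Real.log ε⁻¹ with hl
  have hl1 : 1 ≤ l := by linarith
  -- In terms of `B`, `√T` contains `ε⁻² l²` and `(1 + log T)²` is at most `l²` times a function of
  -- `B`. The powers of `l` cancel, which is why the fourth power of the logarithm suffices.
  set B := T / (ε⁻¹ ^ 4 * l ^ 4) with hB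
  have hpos : 0 < ε⁻¹ ^ 4 * l ^ 4 := by positivity
  have hAB : A ≤ B := by rw [hB, le_div_iff₀ hpos]; linarith
  have hBpos : 0 < B := by linarith
  have hT' : T = B * (ε⁻¹ ^ 4 * l ^ 4) := by rw [hB]; field_simp
  have hsq : √T = √B * (ε⁻¹ ^ 2 * l ^ 2) := by
    rw [hT', Real.sqrt_mul hBpos.le]
    congr 1
    rw [show ε⁻¹ ^ 4 * l ^ 4 = (ε⁻¹ ^ 2 * l ^ 2) ^ 2 by ring]
    exact Real.sqrt_sq (by positivity)
  have hlogB : 0 ≤ Real.log B := Real.log_nonneg (by linarith)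
  -- The `9` is `1 + 4 + 4`, from the logarithms of `ε⁻¹ ^ 4` and `l ^ 4`, each controlled by `l`.
  have hlogT : 1 + Real.log T ≤ (9 + Real.log B) * l := by
    rw [hT', Real.log_mul hBpos.ne' hpos.ne', Real.log_mul (by positivity) (by positivity),
      Real.log_pow, Real.log_pow]
    have h1 := Real.log_le_sub_one_of_pos (by linarith : 0 < l)
    push_cast
    nlinarith
  have hT1 : 1 ≤ T := by
    rw [hT']
    have h1 : 1 ≤ ε⁻¹ ^ 4 := one_le_pow₀ hi
    have h2 : 1 ≤ l ^ 4 := one_le_pow₀ hl1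
    nlinarith [mul_nonneg (sub_nonneg.2 h1) (sub_nonneg.2 h2)]
  have hsqpos : 0 < √T := Real.sqrt_pos.2 (by linarith)
  rw [mul_div_assoc', div_le_iff₀ hsqpos]
  have h0 : 0 ≤ 1 + Real.log T := by linarith [Real.log_nonneg hT1]
  calc K * (1 + Real.log T) ^ 2 ≤ K * ((9 + Real.log B) * l) ^ 2 := by gcongr
    _ = K * (9 + Real.log B) ^ 2 * l ^ 2 := by ring
    _ ≤ √B * l ^ 2 := by gcongr; exact hA B hAB
    _ = ε ^ 2 * √T := by rw [hsq]; field_simp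

end Scalar

/-! ### Evaluation at an independent random time. -/

section RandomTime

variable {S β : Type*} [MeasurableSpace S] [MeasurableSpace β]

/-- Expectation of a family of random variables at an independent random time. -/
theorem lintegral_comp_indep_time_le {P : Measure S} [IsProbabilityMeasure P] {τ : S → ℕ}
    {Z : S → β} (hτ : Measurable τ) (hZ : Measurable Z) (hind : IndepFun τ Z P) {s : Finset ℕ}
    (hs : ∑ k ∈ s, P.real {ω | τ ω = k} = 1) {φ : ℕ → β → ℝ} (hφ : ∀ k, Measurable (φ k))
    (hφ0 : ∀ k z, 0 ≤ φ k z) (hint : ∀ k, Integrable (fun ω => φ k (Z ω)) P) :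
    ∫⁻ ω, ENNReal.ofReal (φ (τ ω) (Z ω)) ∂P
      ≤ ENNReal.ofReal (∑ k ∈ s, P.real {ω | τ ω = k} * ∫ ω, φ k (Z ω) ∂P) := by
  have hmτ : ∀ k, MeasurableSet {ω | τ ω = k} := fun k => hτ (measurableSet_singleton k)
  have hae : ∀ᵐ ω ∂P, τ ω ∈ s := by
    have h1 : P.real (⋃ k ∈ s, {ω | τ ω = k}) = 1 := by
      rw [measureReal_biUnion_finset (fun i _ j _ hij => ?_) (fun k _ => hmτ k), hs]
      exact Set.disjoint_left.2 fun ω (h1 : τ ω = i) (h2 : τ ω = j) => hij (h1.symm.trans h2)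
    have h2 : P (⋃ k ∈ s, {ω | τ ω = k}) = 1 := by
      rw [← ofReal_measureReal (measure_ne_top _ _), h1, ENNReal.ofReal_one]
    have h3 := (prob_compl_eq_zero_iff
      (Finset.measurableSet_biUnion s fun k _ => hmτ k)).2 h2
    filter_upwards [compl_mem_ae_iff.2 h3] with ω hω
    simpa using hω
  -- Splitting by the value of `τ` gives products of a function of `τ` and a function of `Z`, which
  -- independence factors.
  have hsum : ∀ᵐ ω ∂P, ENNReal.ofReal (φ (τ ω) (Z ω))
      = ∑ k ∈ s, ({j | j = k} : Set ℕ).indicator 1 (τ ω) * ENNReal.ofReal (φ k (Z ω)) := by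
    filter_upwards [hae] with ω hω
    rw [Finset.sum_eq_single (τ ω)]
    · simp
    · intro k _ hk
      rw [Set.indicator_of_notMem (by simpa using Ne.symm hk), zero_mul]
    · exact fun h => absurd hω h
  have hmi : ∀ k, Measurable (({j | j = k} : Set ℕ).indicator (1 : ℕ → ℝ≥0∞)) := fun k =>
    measurable_of_countable _
  have hmφ : ∀ k, Measurable fun z => ENNReal.ofReal (φ k z) := fun k => (hφ k).ennreal_ofReal
  have hmul : ∀ k, Measurable fun ω =>
      ({j | j = k} : Set ℕ).indicator 1 (τ ω) * ENNReal.ofReal (φ k (Z ω)) := fun k =>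
    ((hmi k).comp hτ).mul ((hmφ k).comp hZ)
  rw [lintegral_congr_ae hsum, lintegral_finsetSum _ fun k _ => hmul k]
  rw [ENNReal.ofReal_sum_of_nonneg fun k _ => mul_nonneg measureReal_nonneg
    (integral_nonneg fun ω => hφ0 k _)]
  refine Finset.sum_le_sum fun k _ => le_of_eq ?_
  have h1 := lintegral_mul_eq_lintegral_mul_lintegral_of_indepFun ((hmi k).comp hτ)
    ((hmφ k).comp hZ) (hind.comp (hmi k) (hmφ k))
  simp only [Pi.mul_apply, Function.comp_apply] at h1
  rw [h1, ENNReal.ofReal_mul measureReal_nonneg, ofReal_measureReal,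
    ofReal_integral_eq_lintegral_ofReal (hint k) (ae_of_all _ fun ω => hφ0 k _)]
  congr 1
  rw [← lintegral_indicator_one (hmτ k)]
  rfl

end RandomTime

/-! ### Convergence rate and expected stationarity. -/

section Complexity

variable {E X : Type*} [NormedAddCommGroup E] [InnerProductSpace ℝ E] [CompleteSpace E]
  [SecondCountableTopology E] [MeasurableSpace E] [BorelSpace E] [MeasurableSpace X]
  {π : Measure X} {f : E → ℝ} {Θ : Set E} {G : E → X → E} {ρ L₁ L D : ℝ}

namespace Oracle

variable {S : Type*} [MeasurableSpace S] {P : Measure S} [IsProbabilityMeasure P]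
  [IsProbabilityMeasure π] {x y : ℕ → S → X} {it : (ℕ → X) → ℕ → E} {C r : ℝ}

/-- The rate `(1 + log T)² / √T` for the average squared distance to the proximal points. -/
theorem sum_weight_mul_integral_le_rate (h : Oracle π f Θ G ρ L₁ L D) (hit : IsAdapted Θ it)
    (hx : ∀ n, Measurable (x n))
    (hC : 0 ≤ C) (hr₀ : 0 < r) (hr₁ : r < 1) (hmix : ExpMixing P x π C r)
    {w : ℕ → ℝ} (hw0 : ∀ t, 0 ≤ w t) (hw : ∀ s t, 1 ≤ s → s ≤ t → w t ≤ w s)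
    {σ : ℕ → ℕ} (hσ : ∀ t, t ≤ σ t) {κ : ℝ} (hκ : 0 ≤ κ)
    (hpath : PathBound f Θ ρ G w σ it κ) {T : ℕ} (hT : 1 ≤ T)
    (hw1 : w 1 ≤ (∑ t ∈ Finset.Icc 1 T, w t) / √(T : ℝ)) :
    ∑ t ∈ Finset.Icc 1 T,
      w t * ∫ ω, ‖it (fun n => x n ω) t - prox f Θ ρ (it (fun n => x n ω) t)‖ ^ 2 ∂P
    ≤ (κ + ((Real.log r⁻¹)⁻¹ + 2) * (2 * L * D + ((L₁ + ρ) * D + 6 * L) * κ) + 4 * L * D * C)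
        * ((1 + Real.log T) ^ 2 / √(T : ℝ)) * ∑ t ∈ Finset.Icc 1 T, w t := by
  obtain ⟨k, hk1, hkT, hrk⟩ := exists_lag hr₀ hr₁ hT
  have hmain := h.sum_weight_mul_integral_le hit hx hC hr₀ hr₁ hmix hw0 hw hσ hk1
    (hpath.displacement T hT) (hpath.descent T hT)
  refine hmain.trans ?_
  have hL := h.bdd_nonneg
  have hD := h.diam_nonneg
  have hL₁ := h.lip_nonneg
  have hρ := h.smooth.nonneg
  have hT1 : (1 : ℝ) ≤ T := by exact_mod_cast hT
  have hlr : 0 < Real.log r⁻¹ := Real.log_pos ((one_lt_inv₀ hr₀).2 hr₁)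
  have hlog : 0 ≤ Real.log T := Real.log_natCast_nonneg T
  set W := ∑ t ∈ Finset.Icc 1 T, w t with hW
  have hW0 : 0 ≤ W := Finset.sum_nonneg fun t _ => hw0 t
  set V := W / √(T : ℝ) with hV
  have hV0 : 0 ≤ V := by positivity
  set l := 1 + Real.log (T : ℝ) with hl
  have hl1 : 1 ≤ l := by linarith
  set κ' := (Real.log r⁻¹)⁻¹ + 2 with hκ'
  have hκ'0 : 0 ≤ κ' := by positivity
  set Λ := (L₁ + ρ) * D + 6 * L
  have hΛ : 0 ≤ Λ := by positivity
  have e : (κ + κ' * (2 * L * D + Λ * κ) + 4 * L * D * C) * (l ^ 2 / √(T : ℝ)) * W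
      = κ * l ^ 2 * V + κ' * (2 * L * D) * l ^ 2 * V + κ' * (Λ * κ) * l ^ 2 * V
        + 4 * L * D * C * l ^ 2 * V := by
    rw [hV]; ring
  rw [e]
  have hll : l ≤ l ^ 2 := by nlinarith
  have hl2 : 1 ≤ l ^ 2 := hl1.trans hll
  have hrW : r ^ k * W ≤ V := by
    have h1 : (T : ℝ)⁻¹ ≤ (√(T : ℝ))⁻¹ :=
      inv_anti₀ (Real.sqrt_pos.2 (by linarith)) (Real.sqrt_le_self_iff.2 (Or.inr hT1))
    calc r ^ k * W ≤ (√(T : ℝ))⁻¹ * W := by gcongr; exact hrk.trans h1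
      _ = V := by rw [hV]; ring
  have hkl : (k : ℝ) ≤ κ' * l ^ 2 := hkT.trans (by gcongr)
  -- Only the displacement term, lag times path bound, needs two logarithms; the others are rounded
  -- up to `l ^ 2`.
  refine add_le_add (add_le_add (add_le_add ?_ ?_) ?_) ?_
  · gcongr
  · calc (k : ℝ) * w 1 * (2 * L * D) ≤ (κ' * l ^ 2) * V * (2 * L * D) := by
          have := hw0 1
          gcongr
      _ = _ := by ring
  · calc Λ * ((k : ℝ) * (κ * l * V)) ≤ Λ * ((κ' * l) * (κ * l * V)) := by gcongr
      _ = _ := by ring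
  · calc 4 * L * D * C * r ^ k * W = 4 * L * D * C * (r ^ k * W) := by ring
      _ ≤ 4 * L * D * C * (l ^ 2 * V) := by
          refine mul_le_mul_of_nonneg_left (hrW.trans ?_) (by positivity)
          nlinarith
      _ = _ := by ring

/-- Expected stationarity of the minibatch step from the iterate at an independent random
time. -/
theorem lintegral_stationarity_le (h : Oracle π f Θ G ρ L₁ L D) (hit : IsAdapted Θ it)
    (hx : ∀ n, Measurable (x n)) (hy : ∀ n, Measurable (y n))
    (hC : 0 ≤ C) (hr₀ : 0 < r) (hr₁ : r < 1) {n N : ℕ} (hN : 1 ≤ N)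
    (hfresh : FreshBatch P x n y N π C r) {τ : S → ℕ} (hτ : Measurable τ)
    (hind : IndepFun τ (fun ω => ((fun n => x (n + 1) ω), (fun n => y (n + 1) ω))) P)
    {T : ℕ} (hTn : T ≤ n) (hsum : ∑ k ∈ Finset.Icc 1 T, P.real {ω | τ ω = k} = 1)
    {ε : ℝ} (hε : 0 < ε)
    (hX : ∑ k ∈ Finset.Icc 1 T, P.real {ω | τ ω = k} *
      ∫ ω, ‖it (fun n => x n ω) k - prox f Θ ρ (it (fun n => x n ω) k)‖ ^ 2 ∂P
      ≤ ε ^ 2 / (4 * ((3 * ρ + 4) ^ 2) ^ 2))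
    (hNε : 4 * (ρ + 2) ^ 2 * (16 * L ^ 2 * C * (1 - r)⁻¹ + 4 * L ^ 2) ≤ N * ε ^ 2) :
    ∫⁻ ω, stationarity f Θ
      (minibatchStep Θ G N (it (fun n => x n ω) (τ ω)) (fun n => y n ω)) ∂P
      ≤ ENNReal.ofReal ε := by
  have hρ := h.smooth.nonneg
  have hL := h.bdd_nonneg
  have hN0 : (0 : ℝ) < N := by exact_mod_cast hN
  set a := (3 * ρ + 4) ^ 2 with ha
  have ha0 : 0 < a := by positivity
  set b := ρ + 2 with hb
  have hb0 : 0 < b := by positivity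
  set Z : S → (ℕ → X) × (ℕ → X) := fun ω => ((fun n => x (n + 1) ω), (fun n => y (n + 1) ω))
    with hZdef
  have hZ : Measurable Z := (measurable_pi_lambda _ fun n => hx (n + 1)).prodMk
    (measurable_pi_lambda _ fun n => hy (n + 1))
  -- Independence of `τ` covers the samples from index `1` on, so paths are stored shifted; the
  -- wrong entry at index `0` does not affect an adapted process.
  set ϑ : ℕ → (ℕ → X) × (ℕ → X) → E := fun k z => it (fun n => z.1 (n - 1)) k with hϑ
  have hϑm : ∀ k, Measurable (ϑ k) := fun k => (hit.meas k).comp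
    (measurable_pi_lambda _ fun n => (measurable_pi_apply (n - 1)).comp measurable_fst)
  have hϑZ : ∀ k ω, ϑ k (Z ω) = it (fun n => x n ω) k := fun k ω =>
    hit.dep k _ _ fun i h1 _ => by simp [hZdef, Nat.sub_add_cancel h1]
  set U : ℕ → (ℕ → X) × (ℕ → X) → ℝ := fun k z => ‖ϑ k z - prox f Θ ρ (ϑ k z)‖ ^ 2 with hU
  set V : ℕ → (ℕ → X) × (ℕ → X) → ℝ := fun k z =>
    ‖∑ i ∈ Finset.Icc 1 N, (G (ϑ k z) (z.2 (i - 1)) - gradient f (ϑ k z))‖ ^ 2 with hV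
  have hUm : ∀ k, Measurable (U k) := fun k =>
    ((hϑm k).sub (h.smooth.continuous_prox.measurable.comp (hϑm k))).norm.pow_const 2
  have hVm : ∀ k, Measurable (V k) := fun k => by
    refine (Finset.measurable_sum _ fun i _ => ?_).norm.pow_const 2
    exact h.measurable_sub_gradient.comp
      ((hϑm k).prodMk ((measurable_pi_apply (i - 1)).comp measurable_snd))
  have hUi : ∀ k, Integrable (fun ω => U k (Z ω)) P := fun k => by
    refine integrable_of_abs_le (M := D ^ 2) ((hUm k).comp hZ) fun ω => ?_
    rw [abs_of_nonneg (by positivity)]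
    exact pow_le_pow_left₀ (norm_nonneg _) (h.diam _ (hit.mem _ _) _ (h.smooth.prox_mem _)) 2
  have hVi : ∀ k, Integrable (fun ω => V k (Z ω)) P := fun k => by
    refine integrable_of_abs_le (M := (N * (2 * L)) ^ 2) ((hVm k).comp hZ) fun ω => ?_
    rw [abs_of_nonneg (by positivity)]
    refine pow_le_pow_left₀ (norm_nonneg _) ?_ 2
    refine (norm_sum_le _ _).trans ((Finset.sum_le_sum fun i _ =>
      h.norm_sub_gradient_le (hit.mem _ _) _).trans (le_of_eq ?_))
    simp
  -- Young's inequality turns both norms into squares at the price `ε / 2`; the distance and the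
  -- batch error get `ε / 4` each. The pointwise bound also avoids any measurability question for
  -- `stationarity`.
  have hpt : ∀ ω, stationarity f Θ
      (minibatchStep Θ G N (it (fun n => x n ω) (τ ω)) (fun n => y n ω))
      ≤ ENNReal.ofReal (ε / 2 + a ^ 2 / ε * U (τ ω) (Z ω)
        + b ^ 2 / ε * ((N : ℝ)⁻¹ ^ 2 * V (τ ω) (Z ω))) := fun ω => by
    refine (h.smooth.stationarity_proj_le (hit.mem _ _) _).trans (ENNReal.ofReal_le_ofReal ?_)
    set θ := it (fun n => x n ω) (τ ω) with hθ
    have hVe : (N : ℝ)⁻¹ ^ 2 * V (τ ω) (Z ω)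
        = ‖(N : ℝ)⁻¹ • ∑ i ∈ Finset.Icc 1 N, G θ (y i ω) - gradient f θ‖ ^ 2 := by
      have e1 : ∑ i ∈ Finset.Icc 1 N, (G (ϑ (τ ω) (Z ω)) ((Z ω).2 (i - 1))
          - gradient f (ϑ (τ ω) (Z ω)))
          = ∑ i ∈ Finset.Icc 1 N, G θ (y i ω) - (N : ℝ) • gradient f θ := by
        rw [hϑZ, Finset.sum_sub_distrib]
        congr 1
        · refine Finset.sum_congr rfl fun i hi => ?_
          simp only [hZdef, Nat.sub_add_cancel (Finset.mem_Icc.1 hi).1]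
          rfl
        · simp [Nat.cast_smul_eq_nsmul, hθ]
      simp only [hV]
      rw [e1, ← abs_of_nonneg (inv_nonneg.2 hN0.le), ← Real.norm_eq_abs, ← mul_pow, ← norm_smul,
        smul_sub, smul_smul, Real.norm_of_nonneg (inv_nonneg.2 hN0.le),
        inv_mul_cancel₀ hN0.ne', one_smul]
    have hUe : U (τ ω) (Z ω) = ‖θ - prox f Θ ρ θ‖ ^ 2 := by simp only [hU, hϑZ, hθ]
    rw [hVe, hUe]
    have young : ∀ c s : ℝ, c * s ≤ ε / 4 + c ^ 2 / ε * s ^ 2 := fun c s => by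
      have h1 : 0 ≤ (c * s - ε / 2) ^ 2 / ε := by positivity
      have h2 : (c * s - ε / 2) ^ 2 / ε = c ^ 2 / ε * s ^ 2 - c * s + ε / 4 := by
        field_simp; ring
      linarith
    have h1 := young a ‖θ - prox f Θ ρ θ‖
    have h2 := young b ‖(N : ℝ)⁻¹ • ∑ i ∈ Finset.Icc 1 N, G θ (y i ω) - gradient f θ‖
    linarith
  refine (lintegral_mono hpt).trans ?_
  refine (lintegral_comp_indep_time_le hτ hZ hind hsum
    (φ := fun k z => ε / 2 + a ^ 2 / ε * U k z + b ^ 2 / ε * ((N : ℝ)⁻¹ ^ 2 * V k z))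
    (fun k => ((hUm k).const_mul _).const_add _ |>.add (((hVm k).const_mul _).const_mul _))
    (fun k z => by positivity)
    (fun k => ((integrable_const _).add ((hUi k).const_mul _)).add
      (((hVi k).const_mul _).const_mul _))).trans (ENNReal.ofReal_le_ofReal ?_)
  have hVint : ∀ k ∈ Finset.Icc 1 T, b ^ 2 / ε * ((N : ℝ)⁻¹ ^ 2 * ∫ ω, V k (Z ω) ∂P)
      ≤ ε / 4 := fun k hk => by
    have h1 := h.integral_norm_sq_batch_le (P := P) hit hx hy hC hr₀ hr₁
      ((Finset.mem_Icc.1 hk).2.trans hTn) hfresh N le_rfl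
    have h2 : ∫ ω, V k (Z ω) ∂P = ∫ ω, ‖∑ i ∈ Finset.Icc 1 N, (G (it (fun n => x n ω) k) (y i ω)
        - gradient f (it (fun n => x n ω) k))‖ ^ 2 ∂P := by
      congr 1 with ω
      simp only [hV, hϑZ]
      congr 2
      refine Finset.sum_congr rfl fun i hi => ?_
      simp only [hZdef, Nat.sub_add_cancel (Finset.mem_Icc.1 hi).1]
    rw [h2]
    set c := 16 * L ^ 2 * C * (1 - r)⁻¹ + 4 * L ^ 2
    calc _ ≤ b ^ 2 / ε * ((N : ℝ)⁻¹ ^ 2 * (N * c)) := by gcongr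
      _ = (4 * b ^ 2 * c) / (4 * ε * N) := by field_simp
      _ ≤ (N * ε ^ 2) / (4 * ε * N) := by gcongr
      _ = ε / 4 := by field_simp
  have hterm : ∀ k, ∫ ω, (ε / 2 + a ^ 2 / ε * U k (Z ω)
      + b ^ 2 / ε * ((N : ℝ)⁻¹ ^ 2 * V k (Z ω))) ∂P
      = ε / 2 + a ^ 2 / ε * ∫ ω, U k (Z ω) ∂P
        + b ^ 2 / ε * ((N : ℝ)⁻¹ ^ 2 * ∫ ω, V k (Z ω) ∂P) := fun k => by
    have i1 : Integrable (fun ω => ε / 2 + a ^ 2 / ε * U k (Z ω)) P :=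
      (integrable_const _).add ((hUi k).const_mul _)
    rw [integral_add i1 (((hVi k).const_mul _).const_mul _),
      integral_add (integrable_const _) ((hUi k).const_mul _), integral_const_mul,
      integral_const_mul, integral_const_mul]
    simp
  simp only [hterm]
  have hUsum : ∑ k ∈ Finset.Icc 1 T, P.real {ω | τ ω = k} * ∫ ω, U k (Z ω) ∂P
      ≤ ε ^ 2 / (4 * a ^ 2) := by
    simpa only [hU, hϑZ] using hX
  calc ∑ k ∈ Finset.Icc 1 T, P.real {ω | τ ω = k} * (ε / 2 + a ^ 2 / ε * ∫ ω, U k (Z ω) ∂P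
        + b ^ 2 / ε * ((N : ℝ)⁻¹ ^ 2 * ∫ ω, V k (Z ω) ∂P))
      ≤ ∑ k ∈ Finset.Icc 1 T, (P.real {ω | τ ω = k} * (3 * ε / 4)
        + a ^ 2 / ε * (P.real {ω | τ ω = k} * ∫ ω, U k (Z ω) ∂P)) := by
        refine Finset.sum_le_sum fun k hk => ?_
        have h1 := mul_le_mul_of_nonneg_left (hVint k hk)
          (measureReal_nonneg : 0 ≤ P.real {ω | τ ω = k})
        linarith
    _ = 3 * ε / 4 + a ^ 2 / ε
        * ∑ k ∈ Finset.Icc 1 T, P.real {ω | τ ω = k} * ∫ ω, U k (Z ω) ∂P := by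
        rw [Finset.sum_add_distrib, ← Finset.sum_mul, hsum, ← Finset.mul_sum, one_mul]
    _ ≤ 3 * ε / 4 + a ^ 2 / ε * (ε ^ 2 / (4 * a ^ 2)) := by gcongr
    _ = ε := by field_simp; ring

end Oracle

/-- A stochastic gradient that is measurable in the sample and Lipschitz in the parameter becomes
an oracle when it is precomposed with the projection. -/
theorem oracle_proj [IsProbabilityMeasure π] (h : SmoothOn f Θ ρ)
    (hmeas : ∀ θ ∈ Θ, Measurable (G θ)) (hmean : ∀ θ ∈ Θ, ∫ s, G θ s ∂π = gradient f θ)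
    (hL₁ : 0 ≤ L₁) (hlip : ∀ s, ∀ a ∈ Θ, ∀ b ∈ Θ, ‖G a s - G b s‖ ≤ L₁ * ‖a - b‖)
    (hbdd : ∀ θ ∈ Θ, ∀ s, ‖G θ s‖ ≤ L) (hD0 : 0 ≤ D) (hD : ∀ a ∈ Θ, ∀ b ∈ Θ, ‖a - b‖ ≤ D) :
    Oracle π f Θ (fun θ => G (proj Θ θ)) ρ L₁ L D := by
  have hp : ∀ θ ∈ Θ, proj Θ θ = θ := fun θ hθ =>
    proj_eq_self h.nonempty h.compact h.convex hθ
  have hm : ∀ θ, proj Θ θ ∈ Θ := fun θ => (proj_spec h.nonempty h.compact θ).1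
  obtain ⟨θ₀, hθ₀⟩ := h.nonempty
  obtain ⟨s₀⟩ := nonempty_of_isProbabilityMeasure π
  refine ⟨h, ?_, fun θ hθ => by simpa only [hp θ hθ] using hmean θ hθ, fun s a ha b hb => ?_,
    fun θ _ s => hbdd _ (hm θ) s, hD, hL₁, (norm_nonneg _).trans (hbdd θ₀ hθ₀ s₀), hD0⟩
  -- After precomposition with the projection, the gradient is continuous in `θ` on the whole space,
  -- so separate measurability becomes joint (Carathéodory).
  · refine measurable_uncurry_of_continuous_of_measurable (fun s => ?_) fun θ => hmeas _ (hm θ)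
    refine (LipschitzWith.of_dist_le_mul (K := ⟨L₁, hL₁⟩) fun a b => ?_).continuous
    rw [dist_eq_norm, dist_eq_norm]
    exact (hlip s _ (hm a) _ (hm b)).trans (mul_le_mul_of_nonneg_left
      (norm_proj_sub_proj_le h.nonempty h.compact h.convex a b) hL₁)
  · simpa only [hp a ha, hp b hb] using hlip s a ha b hb

end Complexity

end DependentSGD

/-! ### The complexity bound. -/

theorem mainTheorem4 {p : ℕ} {X : Type*} [MeasurableSpace X]
    (π : Measure X) [IsProbabilityMeasure π]
    (Θ : Set (EuclideanSpace ℝ (Fin p))) (hΘ_compact : IsCompact Θ) (hΘ_convex : Convex ℝ Θ)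
    -- `f` is `C¹` near `Θ` with `ρ`-Lipschitz gradient
    (f : EuclideanSpace ℝ (Fin p) → ℝ) (U : Set (EuclideanSpace ℝ (Fin p)))
    (hU : IsOpen U) (hΘU : Θ ⊆ U) (hf : ContDiffOn ℝ 1 f U)
    (ρ : ℝ≥0) (hρ : LipschitzOnWith ρ (gradient f) Θ)
    -- the stochastic gradient: unbiased under `π`, Lipschitz in `θ`, and bounded
    (G : EuclideanSpace ℝ (Fin p) → X → EuclideanSpace ℝ (Fin p))
    (hG_meas : ∀ θ ∈ Θ, Measurable (G θ))
    (hG_mean : ∀ θ ∈ Θ, ∫ s, G θ s ∂π = gradient f θ)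
    (L₁ : ℝ≥0) (hG_lip : ∀ s, LipschitzOnWith L₁ (fun θ => G θ s) Θ)
    (L : ℝ) (hG_bdd : ∀ θ ∈ Θ, ∀ s, ‖G θ s‖ ≤ L)
    -- the mixing constants and the algorithm
    (C r : ℝ) (hr₀ : 0 < r) (hr₁ : r < 1)
    (alg : DependentSGD.Algorithm (EuclideanSpace ℝ (Fin p))) (halg : alg.Admissible) :
    ∃ K : ℝ, 0 < K ∧ ∃ q : ℕ, ∀ ε : ℝ, 0 < ε → ε ≤ 1 →
      ∃ T₀ N₀ : ℕ, 1 ≤ T₀ ∧ 1 ≤ N₀ ∧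
        (N₀ : ℝ) ≤ K * ε⁻¹ ^ 2 ∧
        ((T₀ + 1 + N₀ : ℕ) : ℝ) ≤ K * ε⁻¹ ^ 4 * (1 + Real.log ε⁻¹) ^ q ∧
        ∀ T N : ℕ, T₀ ≤ T → N₀ ≤ N →
        ∀ (S : Type*) [MeasurableSpace S] (P : Measure S) [IsProbabilityMeasure P]
          (x y : ℕ → S → X) (τ : S → ℕ) (θ₁ : EuclideanSpace ℝ (Fin p)),
          (∀ n, Measurable (x n)) → (∀ n, Measurable (y n)) → Measurable τ → θ₁ ∈ Θ →
          DependentSGD.ExpMixing P x π C r →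
          DependentSGD.FreshBatch P x (T + 1) y N π C r →
          IndepFun τ (fun ω => ((fun n => x (n + 1) ω), (fun n => y (n + 1) ω))) P →
          (∀ k ∈ Finset.Icc 1 T,
            P.real {ω | τ ω = k} = alg.weight k / ∑ t ∈ Finset.Icc 1 T, alg.weight t) →
          ∫⁻ ω, DependentSGD.stationarity f Θ
              (DependentSGD.minibatchStep Θ G N
                (alg.iter Θ G θ₁ (fun n => x n ω) (τ ω)) (fun n => y n ω)) ∂P
            ≤ ENNReal.ofReal ε := by
  rcases Θ.eq_empty_or_nonempty with rfl | hne
  · refine ⟨3, by norm_num, 0, fun ε hε hε1 => ⟨1, 1, le_rfl, le_rfl, ?_, ?_, ?_⟩⟩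
    · have h1 : 1 ≤ ε⁻¹ ^ 2 := one_le_pow₀ ((one_le_inv₀ hε).2 hε1)
      push_cast
      linarith
    · have h1 : 1 ≤ ε⁻¹ ^ 4 := one_le_pow₀ ((one_le_inv₀ hε).2 hε1)
      push_cast
      linarith
    · intro T N _ _ S _ P _ x y τ θ₁ _ _ _ hθ₁
      exact absurd hθ₁ (Set.notMem_empty _)
  have hsmooth : DependentSGD.SmoothOn f Θ ρ :=
    { nonempty := hne
      compact := hΘ_compact
      convex := hΘ_convex
      nonneg := ρ.coe_nonneg
      grad := fun θ hθ => ((hf.differentiableOn one_ne_zero).differentiableAt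
        (hU.mem_nhds (hΘU hθ))).hasGradientAt
      lip := fun a ha b hb => by
        simpa only [dist_eq_norm] using hρ.dist_le_mul a ha b hb }
  obtain ⟨D, hD0, hD⟩ := hsmooth.exists_norm_sub_le
  have horacle := DependentSGD.oracle_proj hsmooth hG_meas hG_mean L₁.coe_nonneg
    (fun s a ha b hb => by simpa only [dist_eq_norm] using (hG_lip s).dist_le_mul a ha b hb)
    hG_bdd hD0 hD
  have hL := horacle.bdd_nonneg
  have hρ0 : (0 : ℝ) ≤ ρ := ρ.coe_nonneg
  obtain ⟨κ, hκ, σ, hσ, hpath, hw1⟩ := halg.exists_pathBound hsmooth horacle.bdd hL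
  -- No sign of `C` is assumed; the mixing bounds persist with `|C|`.
  have hC0 : 0 ≤ |C| := abs_nonneg C
  have hCr : ∀ k : ℕ, ENNReal.ofReal (C * r ^ k) ≤ ENNReal.ofReal (|C| * r ^ k) := fun k =>
    ENNReal.ofReal_le_ofReal (mul_le_mul_of_nonneg_right (le_abs_self C) (by positivity))
  set R : ℝ := κ + ((Real.log r⁻¹)⁻¹ + 2) * (2 * L * D + ((L₁ + ρ) * D + 6 * L) * κ)
    + 4 * L * D * |C| with hR
  have hR0 : 0 ≤ R := by
    have := inv_pos.2 (Real.log_pos ((one_lt_inv₀ hr₀).2 hr₁))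
    have : (0 : ℝ) ≤ L₁ := L₁.coe_nonneg
    positivity
  set a : ℝ := (3 * (ρ : ℝ) + 4) ^ 2 with ha
  have ha0 : 0 < a := by positivity
  obtain ⟨A, hA1, hA⟩ := DependentSGD.exists_threshold (4 * a ^ 2 * R) (by positivity)
  set B : ℝ := 4 * ((ρ : ℝ) + 2) ^ 2 * (16 * L ^ 2 * |C| * (1 - r)⁻¹ + 4 * L ^ 2) + 1 with hB
  have hr1 : 0 < (1 - r)⁻¹ := inv_pos.2 (by linarith)
  have hB1 : 1 ≤ B := by
    have : 0 ≤ 4 * ((ρ : ℝ) + 2) ^ 2 * (16 * L ^ 2 * |C| * (1 - r)⁻¹ + 4 * L ^ 2) := by positivity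
    linarith
  -- The `3` absorbs the two ceilings and the extra sample in `T₀ + 1 + N₀`.
  refine ⟨A + B + 3, by linarith, 4, fun ε hε hε1 => ?_⟩
  have hi : 1 ≤ ε⁻¹ := (one_le_inv₀ hε).2 hε1
  have hl1 : 1 ≤ 1 + Real.log ε⁻¹ := by linarith [Real.log_nonneg hi]
  set l := 1 + Real.log ε⁻¹
  have hi2 : 1 ≤ ε⁻¹ ^ 2 := one_le_pow₀ hi
  have hi4 : ε⁻¹ ^ 2 ≤ ε⁻¹ ^ 4 := pow_le_pow_right₀ hi (by norm_num)
  have hl4 : 1 ≤ l ^ 4 := one_le_pow₀ hl1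
  have hil : ε⁻¹ ^ 4 ≤ ε⁻¹ ^ 4 * l ^ 4 := le_mul_of_one_le_right (by positivity) hl4
  have hT₀ : 1 ≤ A * ε⁻¹ ^ 4 * l ^ 4 := by
    rw [mul_assoc]
    exact one_le_mul_of_one_le_of_one_le hA1 (by linarith)
  have hceilT := (Nat.ceil_lt_add_one (by linarith : 0 ≤ A * ε⁻¹ ^ 4 * l ^ 4)).le
  have hceilN := (Nat.ceil_lt_add_one (by positivity : 0 ≤ B * ε⁻¹ ^ 2)).le
  have hN₀ : 1 ≤ B * ε⁻¹ ^ 2 := one_le_mul_of_one_le_of_one_le hB1 hi2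
  refine ⟨⌈A * ε⁻¹ ^ 4 * l ^ 4⌉₊, ⌈B * ε⁻¹ ^ 2⌉₊, Nat.one_le_ceil_iff.2 (by linarith),
    Nat.one_le_ceil_iff.2 (by linarith), ?_, ?_, ?_⟩
  · have h1 : 1 * 1 ≤ (A + 2) * ε⁻¹ ^ 2 := by gcongr; linarith
    linarith
  · push_cast
    have h1 : B * ε⁻¹ ^ 2 ≤ B * (ε⁻¹ ^ 4 * l ^ 4) := by gcongr; linarith
    linarith
  intro T N hT hN S _ P _ x y τ θ₁ hx hy hτ hθ₁ hmix hfresh hind hτw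
  have hT1 : 1 ≤ T := (Nat.one_le_ceil_iff.2 (by linarith)).trans hT
  have hN1 : 1 ≤ N := (Nat.one_le_ceil_iff.2 (by linarith)).trans hN
  have hmix' : DependentSGD.ExpMixing P x π |C| r := fun m n hmn => (hmix m n hmn).trans (hCr _)
  have hfresh' : DependentSGD.FreshBatch P x (T + 1) y N π |C| r := fun i j hj hi =>
    (hfresh i j hj hi).trans (hCr _)
  have hproj : ∀ θ ∈ Θ, G θ = G (DependentSGD.proj Θ θ) := fun θ hθ => by
    rw [DependentSGD.proj_eq_self hne hΘ_compact hΘ_convex hθ]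
  have hit := alg.isAdapted_iter hne hΘ_compact hΘ_convex horacle.meas hθ₁
  have hW : 0 < ∑ t ∈ Finset.Icc 1 T, alg.weight t :=
    halg.weight_one_pos.trans_le (Finset.single_le_sum (f := alg.weight)
      (fun t _ => halg.weight_nonneg t) (Finset.mem_Icc.2 ⟨le_rfl, hT1⟩))
  have hsum : ∑ k ∈ Finset.Icc 1 T, P.real {ω | τ ω = k} = 1 := by
    rw [Finset.sum_congr rfl hτw, ← Finset.sum_div, div_self hW.ne']
  have hrate := horacle.sum_weight_mul_integral_le_rate (P := P) hit hx hC0 hr₀ hr₁ hmix'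
    halg.weight_nonneg halg.weight_anti hσ hκ (hpath θ₁ hθ₁) hT1 (hw1 T hT1)
  have hTε : 4 * a ^ 2 * R * ((1 + Real.log T) ^ 2 / √(T : ℝ)) ≤ ε ^ 2 :=
    hA ε hε hε1 T ((Nat.le_ceil _).trans (by exact_mod_cast hT))
  have hfinal := horacle.lintegral_stationarity_le (P := P) hit hx hy hC0 hr₀ hr₁ hN1 hfresh'
    hτ hind (Nat.le_succ T) hsum hε ?_ ?_
  · refine le_of_eq_of_le (lintegral_congr fun ω => ?_) hfinal
    -- All estimates are for the gradient precomposed with the projection; it agrees with `G` on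
    -- `Θ`, so the output is the same.
    rw [alg.iter_congr hne hΘ_compact hproj hθ₁]
    simp only [DependentSGD.minibatchStep]
    rw [hproj _ (hit.mem _ _)]
  · rw [Finset.sum_congr rfl fun k hk => by rw [hτw k hk, div_mul_eq_mul_div], ← Finset.sum_div,
      div_le_iff₀ hW]
    refine hrate.trans (mul_le_mul_of_nonneg_right ?_ hW.le)
    rw [le_div_iff₀ (by positivity)]
    linarith
  · have h1 : B * ε⁻¹ ^ 2 ≤ N := (Nat.le_ceil _).trans (by exact_mod_cast hN)
    have h2 := mul_le_mul_of_nonneg_right h1 (sq_nonneg ε)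
    rw [mul_assoc, ← mul_pow, inv_mul_cancel₀ hε.ne', one_pow, mul_one] at h2
    linarith
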